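/- Let $p>2$ and $M>0$. There is a constant $C=C(p,M)>0$, depending only on $p$ and $M$, such that the following holds for every $d\in\mathbb N$, every $L>0$ and every curve $\gamma\in C^1([0,L];\mathbb R^d)$ parametrized by arc length ($|\gamma'(s)|=1$ for all $s\in[0,L]$). For $s,t\in[0,L]$ let $r_{\rm tp}^\gamma(\gamma(s),\gamma(t))\in[0,\infty]$ be the radius of the circle through $\gamma(t)$ that is tangent to the line $\gamma(s)+\mathbb R\gamma'(s)$ at $\gamma(s)$, with value $0$ if $\gamma(s)=\gamma(t)$ and value $\infty$ if $\gamma(t)\neq\gamma(s)$ and $\gamma(t)-\gamma(s)$ is parallel to $\gamma'(s)$. Suppose that the tangent-point energy satisfies $$E_{\rm tp}^p(\gamma):=\int_0^L\int_0^L\frac{|\gamma'(s)|\,|\gamma'(t)|}{r_{\rm tp}^\gamma(\gamma(s),\gamma(t))^p}\,ds\,dt\le M .$$ Then 1. $\gamma\in W^{2-\frac1p,p}((0,L);\mathbb R^d)$, that is, $\gamma\in L^p$ and $\gamma$ has a weak derivative in $L^p$ with finite Gagliardo seminorm of order $1-\frac1p$; 2. the image $\gamma([0,L])$ is an embedded one-dimensional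 $C^1$ submanifold of $\mathbb R^d$ with (possibly empty) boundary; 3. $$[\gamma']^p_{W^{1-\frac1p,p}((0,L);\mathbb R^d)}=\int_0^L\int_0^L\frac{|\gamma'(s)-\gamma'(t)|^p}{|s-t|^{p}}\,ds\,dt\le C .$$ -/

import Mathlib

open MeasureTheory Set
open scoped ENNReal ContDiff

noncomputable section

/-- The tangent-point radius of `x` and `y` with respect to the tangent direction `τ` at `x`: the
radius of the smallest sphere that is tangent to the line `x + ℝ τ` at `x` and passes through `y`,
i.e. of the circle in the plane spanned by `τ` and `y - x` that does so. The candidates for the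
centre `c` are the points with `c - x ⟂ τ` and `|c - y| = |c - x|`. The value is `0` if `x = y`
(take `c = x`), and it is `∞`, as the infimum over the empty set, if `x ≠ y` and `y - x` is parallel
to `τ`. -/
def tangentPointRadius {d : ℕ} (x τ y : EuclideanSpace ℝ (Fin d)) : ℝ≥0∞ :=
  ⨅ c ∈ {c : EuclideanSpace ℝ (Fin d) | inner ℝ (c - x) τ = 0 ∧ dist c y = dist c x}, edist c x

/-- The derivative `γ'` of a curve on `[0, L]`, one-sided at the two end points. -/
def curveDeriv {d : ℕ} (L : ℝ) (γ : ℝ → EuclideanSpace ℝ (Fin d)) (s : ℝ) :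
    EuclideanSpace ℝ (Fin d) :=
  derivWithin γ (Icc 0 L) s

/-- The tangent-point energy `∫₀ᴸ ∫₀ᴸ |γ'(s)| |γ'(t)| / r(γ(s), γ(t))ᵖ ds dt`, with values
in `[0, ∞]`. -/
def tangentPointEnergy {d : ℕ} (p L : ℝ) (γ : ℝ → EuclideanSpace ℝ (Fin d)) : ℝ≥0∞ :=
  ∫⁻ t in Icc 0 L, ∫⁻ s in Icc 0 L,
    ‖curveDeriv L γ s‖ₑ * ‖curveDeriv L γ t‖ₑ /
      tangentPointRadius (γ s) (curveDeriv L γ s) (γ t) ^ p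

/-- The `p`-th power `[f]ᵖ` of the Gagliardo seminorm of order `s` on a set `U` of real numbers:
`∫_U ∫_U |f(x) - f(y)|ᵖ / |x - y|^(1 + s p) dx dy`, with values in `[0, ∞]`. -/
def gagliardoPow {d : ℕ} (s p : ℝ) (U : Set ℝ) (f : ℝ → EuclideanSpace ℝ (Fin d)) : ℝ≥0∞ :=
  ∫⁻ y in U, ∫⁻ x in U, ‖f x - f y‖ₑ ^ p / edist x y ^ (1 + s * p)

/-- `f ∈ W^{s,p}(U)` for `0 < s < 1`. -/
def MemSlobodeckij {d : ℕ} (s p : ℝ) (U : Set ℝ) (f : ℝ → EuclideanSpace ℝ (Fin d)) : Prop :=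
  MemLp f (ENNReal.ofReal p) (volume.restrict U) ∧ gagliardoPow s p U f < (⊤ : ℝ≥0∞)

/-- `g` is a weak derivative of `f` on the open set `U` of real numbers. -/
def HasWeakDeriv {d : ℕ} (U : Set ℝ) (f g : ℝ → EuclideanSpace ℝ (Fin d)) : Prop :=
  LocallyIntegrableOn f U ∧ LocallyIntegrableOn g U ∧
    ∀ φ : ℝ → ℝ, ContDiff ℝ ∞ φ → HasCompactSupport φ → tsupport φ ⊆ U →
      ∫ x in U, deriv φ x • f x = -∫ x in U, φ x • g x

/-- `f ∈ W^{1+s,p}(U)` for `0 < s < 1`: `f` is in `L^p(U)` and has a weak derivative in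
`W^{s,p}(U)`. -/
def MemSlobodeckijOne {d : ℕ} (s p : ℝ) (U : Set ℝ) (f : ℝ → EuclideanSpace ℝ (Fin d)) : Prop :=
  MemLp f (ENNReal.ofReal p) (volume.restrict U) ∧
    ∃ g : ℝ → EuclideanSpace ℝ (Fin d), HasWeakDeriv U f g ∧ MemSlobodeckij s p U g

/-- `S` is an embedded one-dimensional `C¹` submanifold of `ℝᵈ` with (possibly empty) boundary:
around each of its points there is a `C¹` diffeomorphism `Φ` between open subsets of `ℝᵈ` that maps
`S` onto a piece of a line through the origin (interior chart) or of a closed ray that starts at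
the origin (boundary chart). -/
def IsEmbeddedOneSubmanifoldWithBoundary {d : ℕ} (S : Set (EuclideanSpace ℝ (Fin d))) : Prop :=
  ∀ x ∈ S, ∃ (Φ : OpenPartialHomeomorph (EuclideanSpace ℝ (Fin d)) (EuclideanSpace ℝ (Fin d)))
      (e : EuclideanSpace ℝ (Fin d)),
    x ∈ Φ.source ∧ ContDiffOn ℝ 1 Φ Φ.source ∧ ContDiffOn ℝ 1 Φ.symm Φ.target ∧ e ≠ 0 ∧
      (Φ '' (Φ.source ∩ S) = Φ.target ∩ {y | ∃ c : ℝ, y = c • e} ∨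
        Φ '' (Φ.source ∩ S) = Φ.target ∩ {y | ∃ c : ℝ, 0 ≤ c ∧ y = c • e})

end

/-! The seminorm bound is linear in the energy. If the tangent turns by at most `1` between two
parameters, both tangents are acute to the chord, and the deviation of each from the chord direction
is controlled by its tangent-point curvature. Hence `|γ'(s) - γ'(t)| ≤ |s - t| (1/r + 1/r')`, and
the energy dominates this part of the seminorm.

For the remaining "turning pairs", `|γ'(s) - γ'(t)| ≤ 2`, so it suffices to integrate `|s - t|^(-p)`
over them. The interval is cut greedily into steps on which the tangent turns by `1/4`. The
Morrey-type estimate for `p > 2` (`exists_rpow_le_lintegral_diffQuotPow`) shows that a step of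
length `ℓ` carries energy at least a constant times `ℓ^(2-p)`. A turning pair must jump over a whole
step, and the kernel integrated over all pairs that jump over a given step is also a constant times
`ℓ^(2-p)`. The squares over the steps are disjoint, so their energies add up to at most the total
(`exists_lintegral_turningPairsAbove_le`). Neither injectivity nor a bound on the length enters.

The submanifold property rests on a self-contact argument (`mem_image_of_foot_points`). Suppose that
another passage of the curve meets a short arc and leaves it at time `u₀`. At time `t` its distance
`ρ` to the arc is at most `|t - u₀|`, and parameters near the foot point, over a length comparable
to `ρ`, see curvature of order `1/ρ`. They contribute `ρ^(1-p) ≥ |t - u₀|^(1-p)` up to a constant,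
which is not integrable in `t`. So locally the image is a single arc, which the inverse function
theorem straightens. The end points need a case distinction. -/

noncomputable section


/-! ### Tangent-point curvature of a pair of points. -/

section Geometry

variable {E : Type*} [NormedAddCommGroup E] [InnerProductSpace ℝ E]

/-- The curvature of the circle through `y` that is tangent to `x + ℝ τ` at `x`, for a unit
vector `τ`. -/
def tangentPointCurvature (x τ y : E) : ℝ :=
  2 * ‖(y - x) - inner ℝ τ (y - x) • τ‖ / ‖y - x‖ ^ 2

theorem tangentPointCurvature_nonneg (x τ y : E) : 0 ≤ tangentPointCurvature x τ y := by
  unfold tangentPointCurvature; positivity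

theorem inner_sub_inner_smul {τ : E} (hτ : ‖τ‖ = 1) (w : E) :
    inner ℝ (w - inner ℝ τ w • τ) τ = 0 := by
  rw [inner_sub_left, inner_smul_left, real_inner_self_eq_norm_sq, hτ, real_inner_comm]
  simp

theorem norm_sq_sub_inner_smul {τ : E} (hτ : ‖τ‖ = 1) (w : E) :
    ‖w - inner ℝ τ w • τ‖ ^ 2 = ‖w‖ ^ 2 - inner ℝ τ w ^ 2 := by
  rw [norm_sub_sq_real, inner_smul_right, norm_smul, hτ, real_inner_comm, Real.norm_eq_abs,
    mul_one, sq_abs]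
  ring

/-- A chord that makes an acute angle with the unit vector `τ`. -/
theorem norm_sub_norm_smul_le {τ w : E} (hτ : ‖τ‖ = 1) (h : 0 ≤ inner ℝ τ w) :
    ‖w - ‖w‖ • τ‖ ≤ 2 * ‖w - inner ℝ τ w • τ‖ := by
  have h1 : inner ℝ τ w ≤ ‖w‖ := by simpa [hτ] using real_inner_le_norm τ w
  have h2 : ‖w - ‖w‖ • τ‖ ^ 2 = 2 * ‖w‖ * (‖w‖ - inner ℝ τ w) := by
    rw [norm_sub_sq_real, inner_smul_right, norm_smul, hτ, real_inner_comm, Real.norm_eq_abs,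
      mul_one, sq_abs]
    ring
  have h3 := norm_sq_sub_inner_smul hτ w
  refine abs_le_of_sq_le_sq' ?_ (by positivity) |>.2
  rw [h2, mul_pow, h3]
  nlinarith [mul_nonneg (sub_nonneg.2 h1) h, mul_nonneg (sub_nonneg.2 h1) (norm_nonneg w)]

/-- Both unit vectors are compared with the direction of the chord. The sign conditions exclude a
tangent that is nearly opposite to the chord, where the curvature would be small as well. -/
theorem norm_sub_le_tangentPointCurvature {x y τ σ : E} (hτ : ‖τ‖ = 1) (hσ : ‖σ‖ = 1)
    (h1 : 0 < inner ℝ τ (y - x)) (h2 : 0 ≤ inner ℝ σ (y - x)) :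
    ‖τ - σ‖ ≤ ‖y - x‖ * (tangentPointCurvature x τ y + tangentPointCurvature y σ x) := by
  have hw : 0 < ‖y - x‖ := by
    rw [norm_pos_iff]; rintro h; simp [h] at h1
  have hK : tangentPointCurvature y σ x
      = 2 * ‖(y - x) - inner ℝ σ (y - x) • σ‖ / ‖y - x‖ ^ 2 := by
    unfold tangentPointCurvature
    rw [norm_sub_rev x y, ← neg_sub y x, inner_neg_right, neg_smul, ← neg_add', norm_neg,
      ← sub_eq_add_neg]
  rw [hK]
  unfold tangentPointCurvature
  set w := y - x
  have h3 : ‖w‖ * ‖τ - σ‖ ≤ ‖w - ‖w‖ • τ‖ + ‖w - ‖w‖ • σ‖ := by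
    have : ‖w‖ * ‖τ - σ‖ = ‖(w - ‖w‖ • σ) - (w - ‖w‖ • τ)‖ := by
      rw [sub_sub_sub_cancel_left, ← smul_sub, norm_smul, norm_norm]
    rw [this, add_comm]
    exact norm_sub_le _ _
  have h4 := norm_sub_norm_smul_le hτ h1.le
  have h5 := norm_sub_norm_smul_le hσ h2
  have : ‖w‖ * (2 * ‖w - inner ℝ τ w • τ‖ / ‖w‖ ^ 2 + 2 * ‖w - inner ℝ σ w • σ‖ / ‖w‖ ^ 2)
      = (2 * ‖w - inner ℝ τ w • τ‖ + 2 * ‖w - inner ℝ σ w • σ‖) / ‖w‖ := by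
    field_simp
  rw [this, le_div_iff₀ hw]
  linarith

end Geometry

/-- The radius is an infimum over centres, so one admissible centre suffices. Only this direction is
needed to pass from the given energy to curvatures. For `y = x` the left side is `0` by the
convention for division by zero. -/
theorem ofReal_tangentPointCurvature_le {d : ℕ} {x τ y : EuclideanSpace ℝ (Fin d)}
    (hτ : ‖τ‖ = 1) :
    ENNReal.ofReal (tangentPointCurvature x τ y) ≤ (tangentPointRadius x τ y)⁻¹ := by
  rcases (tangentPointCurvature_nonneg x τ y).eq_or_lt with h0 | h0
  · simp [← h0]
  rw [ENNReal.le_inv_iff_le_inv, ← ENNReal.ofReal_inv_of_pos h0]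
  unfold tangentPointCurvature at *
  set w := y - x with hw
  set q := w - inner ℝ τ w • τ with hq
  have hw0 : 0 < ‖w‖ := by
    rw [norm_pos_iff]; rintro h; simp [h] at h0
  have hq0 : 0 < ‖q‖ := by
    rw [norm_pos_iff]; rintro h; simp [h] at h0
  -- The point on the normal ray through `q` that is equidistant from `x` and `y`. Its distance to
  -- `x` is `‖w‖² / (2‖q‖)`.
  set c := x + (‖w‖ ^ 2 / (2 * ‖q‖ ^ 2)) • q with hc
  have hcx : c - x = (‖w‖ ^ 2 / (2 * ‖q‖ ^ 2)) • q := by simp [hc]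
  have hqτ : inner ℝ q τ = 0 := inner_sub_inner_smul hτ w
  have hqw : inner ℝ q w = ‖q‖ ^ 2 := by
    have : w = q + inner ℝ τ w • τ := by simp [hq]
    nth_rw 1 [this]
    rw [inner_add_right, inner_smul_right, hqτ, real_inner_self_eq_norm_sq]
    ring
  have hmem : c ∈ {c : EuclideanSpace ℝ (Fin d) |
      inner ℝ (c - x) τ = 0 ∧ dist c y = dist c x} := by
    refine ⟨by rw [hcx, inner_smul_left, hqτ]; simp, ?_⟩
    rw [dist_eq_norm, dist_eq_norm]
    have h1 : c - y = (c - x) - w := by simp [hw]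
    rw [← sq_eq_sq₀ (norm_nonneg _) (norm_nonneg _), h1, norm_sub_sq_real, hcx, inner_smul_left,
      hqw]
    simp only [conj_trivial]
    field_simp
    ring
  refine (iInf₂_le c hmem).trans ?_
  rw [edist_dist, dist_eq_norm, hcx, norm_smul]
  refine ENNReal.ofReal_le_ofReal (le_of_eq ?_)
  rw [Real.norm_of_nonneg (by positivity)]
  field_simp

/-! ### Chords and tangents of unit-speed curves. -/

section UnitSpeed

variable {E : Type*} [NormedAddCommGroup E] [InnerProductSpace ℝ E]

theorem half_le_inner_of_norm_sub_le {a b : E} (ha : ‖a‖ = 1) (hb : ‖b‖ = 1)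
    (h : ‖a - b‖ ≤ 1) : 1 / 2 ≤ inner ℝ a b := by
  have h1 := norm_sub_sq_real a b
  rw [ha, hb] at h1
  nlinarith [norm_nonneg (a - b)]

/-- A lower bound for the component of a chord in the direction `τ`. -/
theorem mul_le_inner_sub {G v : ℝ → E} (hG : ∀ s, HasDerivAt G (v s) s) {τ : E} {c s t : ℝ}
    (hst : s ≤ t) (h : ∀ u ∈ Icc s t, c ≤ inner ℝ τ (v u)) :
    c * (t - s) ≤ inner ℝ τ (G t - G s) := by
  have hd : ∀ u, HasDerivAt (fun u => inner ℝ τ (G u)) (inner ℝ τ (v u)) u := fun u => by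
    simpa using (hasDerivAt_const u τ).inner ℝ (hG u)
  have := (convex_Icc s t).mul_sub_le_image_sub_of_le_deriv (f := fun u => inner ℝ τ (G u))
    (fun u _ => (hd u).continuousAt.continuousWithinAt)
    (fun u _ => (hd u).differentiableAt.differentiableWithinAt) (C := c)
    (fun u hu => by rw [(hd u).deriv]; exact h u (interior_subset hu)) s (left_mem_Icc.2 hst) t
    (right_mem_Icc.2 hst) hst
  rwa [inner_sub_right]

theorem norm_sub_le_of_unit_speed {G v : ℝ → E} (hG : ∀ s, HasDerivAt G (v s) s)
    (hu : ∀ s, ‖v s‖ = 1) (s t : ℝ) : ‖G t - G s‖ ≤ |t - s| := by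
  have := Convex.norm_image_sub_le_of_norm_hasDerivWithin_le (f := G) (f' := v) (s := univ)
    (C := 1) (fun x _ => (hG x).hasDerivWithinAt) (fun x _ => (hu x).le) convex_univ
    (mem_univ s) (mem_univ t)
  simpa using this

/-- If the tangent turns by at most `1` between `s` and `t`, its difference quotient is bounded by
the two tangent-point curvatures. -/
theorem norm_deriv_sub_le_of_osc_le {G v : ℝ → E} (hG : ∀ s, HasDerivAt G (v s) s)
    (hu : ∀ s, ‖v s‖ = 1) {s t : ℝ}
    (hosc : ∀ u ∈ uIcc s t, ∀ u' ∈ uIcc s t, ‖v u - v u'‖ ≤ 1) :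
    ‖v s - v t‖ ≤ |s - t| *
      (tangentPointCurvature (G s) (v s) (G t) + tangentPointCurvature (G t) (v t) (G s)) := by
  wlog hst : s ≤ t generalizing s t
  · have := this (s := t) (t := s) (by rwa [uIcc_comm]) (le_of_not_ge hst)
    rwa [norm_sub_rev, abs_sub_comm, add_comm]
  rcases hst.eq_or_lt with rfl | hst'
  · simp
  rw [uIcc_of_le hst] at hosc
  have hs := left_mem_Icc.2 hst
  have ht := right_mem_Icc.2 hst
  -- Turning by at most `1` makes all tangents in between acute to both end tangents, hence so is
  -- the chord.
  have h1 := mul_le_inner_sub hG (τ := v s) (c := 1 / 2) hst fun u hu' =>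
    half_le_inner_of_norm_sub_le (hu s) (hu u) (hosc s hs u hu')
  have h2 := mul_le_inner_sub hG (τ := v t) (c := 1 / 2) hst fun u hu' =>
    half_le_inner_of_norm_sub_le (hu t) (hu u) (hosc t ht u hu')
  refine (norm_sub_le_tangentPointCurvature (hu s) (hu t) (by linarith) (by linarith)).trans ?_
  refine mul_le_mul_of_nonneg_right ?_
    (add_nonneg (tangentPointCurvature_nonneg _ _ _) (tangentPointCurvature_nonneg _ _ _))
  rw [abs_sub_comm]
  exact norm_sub_le_of_unit_speed hG hu s t

end UnitSpeed


/-! ### A Morrey-type estimate for the Gagliardo seminorm of order `1 - 1/p`. -/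

section Morrey

variable {E : Type*} [NormedAddCommGroup E]

theorem le_add_rpow_one_sub_mul_rpow {p l x : ℝ} (hp : 1 ≤ p) (hl : 0 < l) (hx : 0 ≤ x) :
    x ≤ l + l ^ (1 - p) * x ^ p := by
  rcases le_total x l with h | h
  · have : 0 ≤ l ^ (1 - p) * x ^ p := by positivity
    linarith
  · have hx0 : 0 < x := hl.trans_le h
    have h1 : 1 ≤ (x / l) ^ (p - 1) := Real.one_le_rpow ((one_le_div hl).2 h) (by linarith)
    have h2 : l ^ (1 - p) * x ^ p = x * (x / l) ^ (p - 1) := by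
      rw [Real.div_rpow hx0.le hl.le, Real.rpow_sub hx0, Real.rpow_one, Real.rpow_sub hl,
        Real.rpow_sub hl, Real.rpow_one]
      field_simp
    rw [h2]
    nlinarith

/-- Young-type splitting at the threshold `m = c (r/l)^a` with `a = (p-2)/p`. This exponent makes
the first term integrable at `r = 0` after integration over an interval of length `r`, while `a p =
p - 2` reduces the coefficient of the second to `c^(1-p) l^(p-2) (r/l)^a`, which is bounded
uniformly in `r`. -/
theorem inv_sq_mul_le {p c l r h x : ℝ} (hp : 2 < p) (hc : 0 < c) (hr : 0 < r) (hrl : r ≤ l)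
    (hh : 0 < h) (hhr : h ≤ r) (hx : 0 ≤ x) :
    (r ^ 2)⁻¹ * x ≤ c * l ^ (-((p - 2) / p)) * r ^ ((p - 2) / p - 1) * r⁻¹
      + c ^ (1 - p) * l ^ (p - 2) * (x / h) ^ p := by
  set a := (p - 2) / p with ha
  have hp0 : 0 < p := by linarith
  have ha0 : 0 < a := div_pos (by linarith) hp0
  have hap : a * p = p - 2 := by rw [ha]; field_simp
  have hl : 0 < l := hr.trans_le hrl
  set m := c * (r / l) ^ a with hm
  have hm0 : 0 < m := by positivity
  have h1 := le_add_rpow_one_sub_mul_rpow (p := p) (by linarith) hm0 hx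
  have h2 : (r ^ 2)⁻¹ * m = c * l ^ (-a) * r ^ (a - 1) * r⁻¹ := by
    rw [hm, Real.div_rpow hr.le hl.le, Real.rpow_neg hl.le, Real.rpow_sub hr, Real.rpow_one]
    field_simp
  have h3 : x ^ p ≤ (x / h) ^ p * r ^ p := by
    rw [← Real.mul_rpow (by positivity) hr.le]
    refine Real.rpow_le_rpow hx ?_ hp0.le
    rw [div_mul_eq_mul_div, le_div_iff₀ hh]
    gcongr
  have h4 : (r ^ 2)⁻¹ * (m ^ (1 - p) * r ^ p) ≤ c ^ (1 - p) * l ^ (p - 2) := by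
    have e1 : m ^ (1 - p) = c ^ (1 - p) * (r / l) ^ (a - (p - 2)) := by
      rw [hm, Real.mul_rpow hc.le (by positivity), ← Real.rpow_mul (by positivity)]
      congr 2
      rw [mul_sub, hap, mul_one]
    have e2 : (r ^ 2)⁻¹ * r ^ p = r ^ (p - 2) := by
      rw [Real.rpow_sub hr, Real.rpow_two]; field_simp
    have e3 : (r / l) ^ (a - (p - 2)) * r ^ (p - 2) = (r / l) ^ a * l ^ (p - 2) := by
      rw [Real.rpow_sub (by positivity), Real.div_rpow hr.le hl.le (p - 2)]
      field_simp
    calc (r ^ 2)⁻¹ * (m ^ (1 - p) * r ^ p)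
        = c ^ (1 - p) * ((r / l) ^ (a - (p - 2)) * ((r ^ 2)⁻¹ * r ^ p)) := by rw [e1]; ring
      _ = c ^ (1 - p) * l ^ (p - 2) * (r / l) ^ a := by rw [e2, e3]; ring
      _ ≤ c ^ (1 - p) * l ^ (p - 2) * 1 := by
          gcongr
          exact Real.rpow_le_one (by positivity) ((div_le_one hl).2 hrl) ha0.le
      _ = _ := mul_one _
  calc (r ^ 2)⁻¹ * x ≤ (r ^ 2)⁻¹ * (m + m ^ (1 - p) * ((x / h) ^ p * r ^ p)) := by
        gcongr
        refine h1.trans ?_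
        gcongr
    _ = (r ^ 2)⁻¹ * m + (r ^ 2)⁻¹ * (m ^ (1 - p) * r ^ p) * (x / h) ^ p := by ring
    _ ≤ _ := by
        rw [h2]
        gcongr

/-- The integrand of the Gagliardo seminorm of order `1 - 1 / p`. -/
def diffQuotPow (p : ℝ) (f : ℝ → E) (x y : ℝ) : ℝ≥0∞ :=
  (‖f x - f y‖ₑ / edist x y) ^ p

theorem diffQuotPow_comm (p : ℝ) (f : ℝ → E) (x y : ℝ) :
    diffQuotPow p f x y = diffQuotPow p f y x := by
  unfold diffQuotPow
  rw [edist_comm, ← edist_eq_enorm_sub, ← edist_eq_enorm_sub, edist_comm]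

theorem diffQuotPow_eq_ofReal {p : ℝ} (hp : 0 ≤ p) (f : ℝ → E) {x y : ℝ} (h : x ≠ y) :
    diffQuotPow p f x y = ENNReal.ofReal ((‖f x - f y‖ / |x - y|) ^ p) := by
  unfold diffQuotPow
  rw [edist_dist, Real.dist_eq, ← ofReal_norm,
    ← ENNReal.ofReal_div_of_pos (abs_pos.2 (sub_ne_zero.2 h)),
    ENNReal.ofReal_rpow_of_nonneg (by positivity) hp]

theorem measurable_diffQuotPow (p : ℝ) {f : ℝ → E} (hf : Continuous f) :
    Measurable fun z : ℝ × ℝ => diffQuotPow p f z.1 z.2 := by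
  unfold diffQuotPow
  refine Measurable.pow_const (Measurable.div ?_ ?_) p
  · exact (by fun_prop : Continuous fun z : ℝ × ℝ => ‖f z.1 - f z.2‖ₑ).measurable
  · exact measurable_edist

variable [NormedSpace ℝ E]

theorem lintegral_rpow_sub_one {a c l : ℝ} (ha : 0 < a) (hc : 0 < c) (hl : 0 < l) :
    ∫⁻ r in Ioc 0 l, ENNReal.ofReal (c * l ^ (-a) * r ^ (a - 1)) = ENNReal.ofReal (c / a) := by
  have hi : IntervalIntegrable (fun r : ℝ => c * l ^ (-a) * r ^ (a - 1)) volume 0 l :=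
    (intervalIntegral.intervalIntegrable_rpow' (by linarith)).const_mul _
  rw [← ofReal_integral_eq_lintegral_ofReal ((intervalIntegrable_iff_integrableOn_Ioc_of_le
    hl.le).1 hi), ← intervalIntegral.integral_of_le hl.le, intervalIntegral.integral_const_mul,
    integral_rpow (Or.inl (by linarith))]
  · congr 1
    rw [sub_add_cancel, Real.zero_rpow ha.ne', Real.rpow_neg hl.le]
    have : 0 < l ^ a := by positivity
    field_simp
    ring
  · refine (ae_restrict_mem measurableSet_Ioc).mono fun r hr => ?_
    have := hr.1
    simp only [Pi.zero_apply]
    positivity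

theorem enorm_deriv_average_le {p c l r : ℝ} (hp : 2 < p) (hc : 0 < c) (hr : 0 < r) (hrl : r ≤ l)
    {f : ℝ → E} (hf : Continuous f) :
    ‖(r ^ 2)⁻¹ • ∫ x in (0 : ℝ)..r, (f r - f x)‖ₑ ≤
      ENNReal.ofReal (c * l ^ (-((p - 2) / p)) * r ^ ((p - 2) / p - 1)) +
        ENNReal.ofReal (c ^ (1 - p) * l ^ (p - 2)) * ∫⁻ x in Ioc 0 l, diffQuotPow p f r x := by
  set B := c * l ^ (-((p - 2) / p)) * r ^ ((p - 2) / p - 1) with hB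
  have hl : 0 < l := hr.trans_le hrl
  have hB0 : 0 ≤ B := by positivity
  have hm : Measurable fun x => diffQuotPow p f r x :=
    (measurable_diffQuotPow p hf).comp (measurable_const.prodMk measurable_id)
  calc ‖(r ^ 2)⁻¹ • ∫ x in (0 : ℝ)..r, (f r - f x)‖ₑ
      ≤ ∫⁻ x in Ioc 0 r, ‖(r ^ 2)⁻¹ • (f r - f x)‖ₑ := by
        rw [← intervalIntegral.integral_smul, intervalIntegral.integral_of_le hr.le]
        exact enorm_integral_le_lintegral_enorm _
    _ ≤ ∫⁻ x in Ioc 0 r, (ENNReal.ofReal (B * r⁻¹) +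
          ENNReal.ofReal (c ^ (1 - p) * l ^ (p - 2)) * diffQuotPow p f r x) := by
        refine setLIntegral_mono' measurableSet_Ioc fun x hx => ?_
        rcases eq_or_ne r x with rfl | hne
        · simp
        have hxr : 0 < r - x := sub_pos.2 (lt_of_le_of_ne hx.2 hne.symm)
        have := inv_sq_mul_le hp hc hr hrl hxr (by linarith [hx.1]) (norm_nonneg (f r - f x))
        rw [diffQuotPow_eq_ofReal (by linarith) f hne, ← ofReal_norm, norm_smul,
          Real.norm_of_nonneg (by positivity), ← ENNReal.ofReal_mul (by positivity),
          ← ENNReal.ofReal_add (by positivity) (by positivity), abs_of_pos hxr]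
        exact ENNReal.ofReal_le_ofReal this
    _ = ENNReal.ofReal B + ENNReal.ofReal (c ^ (1 - p) * l ^ (p - 2)) *
          ∫⁻ x in Ioc 0 r, diffQuotPow p f r x := by
        rw [lintegral_add_left measurable_const, lintegral_const_mul _ hm, setLIntegral_const,
          Real.volume_Ioc, sub_zero, ← ENNReal.ofReal_mul (by positivity)]
        rw [inv_mul_cancel_right₀ hr.ne']
    _ ≤ _ := by
        gcongr

variable [CompleteSpace E]

theorem hasDerivAt_average {f : ℝ → E} (hf : Continuous f) {r : ℝ} (hr : r ≠ 0) :
    HasDerivAt (fun r : ℝ => r⁻¹ • ∫ x in (0 : ℝ)..r, f x)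
      ((r ^ 2)⁻¹ • ∫ x in (0 : ℝ)..r, (f r - f x)) r := by
  have h1 : HasDerivAt (fun r : ℝ => ∫ x in (0 : ℝ)..r, f x) (f r) r :=
    intervalIntegral.integral_hasDerivAt_right (hf.intervalIntegrable _ _)
      (hf.stronglyMeasurableAtFilter _ _) hf.continuousAt
  have h2 := (hasDerivAt_inv hr).smul h1
  refine h2.congr_deriv ?_
  rw [intervalIntegral.integral_sub (by simp) (hf.intervalIntegrable _ _),
    intervalIntegral.integral_const, sub_zero, smul_sub, smul_smul, neg_smul, ← sub_eq_add_neg,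
    pow_two, mul_inv, inv_mul_cancel_right₀ hr]

theorem tendsto_average_zero {f : ℝ → E} (hf : Continuous f) :
    Filter.Tendsto (fun r : ℝ => r⁻¹ • ∫ x in (0 : ℝ)..r, f x) (nhdsWithin 0 (Ioi 0))
      (nhds (f 0)) := by
  have h1 : HasDerivAt (fun r : ℝ => ∫ x in (0 : ℝ)..r, f x) (f 0) 0 :=
    intervalIntegral.integral_hasDerivAt_right (hf.intervalIntegrable _ _)
      (hf.stronglyMeasurableAtFilter _ _) hf.continuousAt
  have := hasDerivAt_iff_tendsto_slope_zero.1 h1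
  simp only [zero_add, intervalIntegral.integral_same, sub_zero] at this
  exact this.mono_left (nhdsWithin_mono _ fun x hx => (ne_of_gt hx : x ≠ 0))

/-- The average over `[0, r]` tends to `f 0` as `r → 0`, so its derivative in `r` is integrated over
`(0, l]`. The free parameter `c` makes the first error term small. -/
theorem enorm_average_sub_le {p c l : ℝ} (hp : 2 < p) (hc : 0 < c) (hl : 0 < l) {f : ℝ → E}
    (hf : Continuous f) :
    ‖(l⁻¹ • ∫ x in (0 : ℝ)..l, f x) - f 0‖ₑ ≤ ENNReal.ofReal (c / ((p - 2) / p)) +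
        ENNReal.ofReal (c ^ (1 - p) * l ^ (p - 2)) *
          ∫⁻ r in Ioc 0 l, ∫⁻ x in Ioc 0 l, diffQuotPow p f r x := by
  set A := fun r : ℝ => r⁻¹ • ∫ x in (0 : ℝ)..r, f x with hA
  have hlim : Filter.Tendsto (fun e => ‖A l - A e‖ₑ) (nhdsWithin 0 (Ioi 0))
      (nhds ‖A l - f 0‖ₑ) :=
    (tendsto_const_nhds.sub (tendsto_average_zero hf)).enorm
  refine le_of_tendsto hlim ?_
  filter_upwards [Ioo_mem_nhdsGT hl] with e he
  have hcont : ContinuousOn (fun r : ℝ => (r ^ 2)⁻¹ • ∫ x in (0 : ℝ)..r, (f r - f x))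
      (uIcc e l) := by
    have h1 : Continuous fun r : ℝ => ∫ x in (0 : ℝ)..r, f x :=
      intervalIntegral.continuous_primitive (fun a b => hf.intervalIntegrable a b) 0
    have h2 : ∀ r : ℝ, ∫ x in (0 : ℝ)..r, (f r - f x) = r • f r - ∫ x in (0 : ℝ)..r, f x := by
      intro r
      rw [intervalIntegral.integral_sub (by simp) (hf.intervalIntegrable _ _),
        intervalIntegral.integral_const, sub_zero]
    simp only [h2]
    refine ContinuousOn.smul (ContinuousOn.inv₀ (by fun_prop) ?_) (by fun_prop)
    intro r hr
    rw [uIcc_of_le he.2.le] at hr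
    have := he.1.trans_le hr.1
    positivity
  have hftc : ∫ r in e..l, ((r ^ 2)⁻¹ • ∫ x in (0 : ℝ)..r, (f r - f x)) = A l - A e := by
    refine intervalIntegral.integral_eq_sub_of_hasDerivAt (fun r hr => ?_)
      hcont.intervalIntegrable
    rw [uIcc_of_le he.2.le] at hr
    exact hasDerivAt_average hf (he.1.trans_le hr.1).ne'
  rw [← hftc, intervalIntegral.integral_of_le he.2.le]
  refine (enorm_integral_le_lintegral_enorm _).trans ?_
  have hsub : Ioc e l ⊆ Ioc 0 l := Ioc_subset_Ioc_left he.1.le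
  calc ∫⁻ r in Ioc e l, ‖(r ^ 2)⁻¹ • ∫ x in (0 : ℝ)..r, (f r - f x)‖ₑ
      ≤ ∫⁻ r in Ioc 0 l, ‖(r ^ 2)⁻¹ • ∫ x in (0 : ℝ)..r, (f r - f x)‖ₑ :=
        lintegral_mono_set hsub
    _ ≤ ∫⁻ r in Ioc 0 l, (ENNReal.ofReal (c * l ^ (-((p - 2) / p)) * r ^ ((p - 2) / p - 1)) +
        ENNReal.ofReal (c ^ (1 - p) * l ^ (p - 2)) * ∫⁻ x in Ioc 0 l, diffQuotPow p f r x) :=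
        setLIntegral_mono' measurableSet_Ioc fun r hr =>
          enorm_deriv_average_le hp hc hr.1 hr.2 hf
    _ = _ := by
        rw [lintegral_add_left (by fun_prop), lintegral_rpow_sub_one
          (div_pos (by linarith) (by linarith)) hc hl, lintegral_const_mul]
        exact (measurable_diffQuotPow p hf).lintegral_prod_right'

/-- The Morrey-type embedding of `W^{1-1/p,p}` on an interval, `p > 2`: a continuous function that
oscillates by `η` on an interval has a seminorm that is bounded below on it. -/
theorem exists_rpow_le_lintegral_diffQuotPow {p η : ℝ} (hp : 2 < p) (hη : 0 < η) :
    ∃ C : ℝ, 0 < C ∧ ∀ {E : Type} [NormedAddCommGroup E] [NormedSpace ℝ E] [CompleteSpace E]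
      (f : ℝ → E) (a b : ℝ), Continuous f → a < b → η ≤ ‖f b - f a‖ →
        ENNReal.ofReal ((b - a) ^ (2 - p)) ≤
          ENNReal.ofReal C * ∫⁻ x in Ioc a b, ∫⁻ y in Ioc a b, diffQuotPow p f x y := by
  set α := (p - 2) / p
  have hα : 0 < α := div_pos (by linarith) (by linarith)
  -- With this choice `c / α = η / 8`. Comparing both end values with the common average leaves at
  -- least `η / 2` to be paid by the seminorm.
  set c := α * η / 8 with hc
  have hc0 : 0 < c := by positivity
  refine ⟨4 * c ^ (1 - p) / η, by positivity, ?_⟩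
  intro E _ _ _ f a b hf hab hosc
  set l := b - a
  have hl : 0 < l := sub_pos.2 hab
  set I := ∫⁻ x in Ioc a b, ∫⁻ y in Ioc a b, diffQuotPow p f x y with hI
  have cv1 : ∀ g : ℝ → ℝ≥0∞, ∫⁻ x in Ioc 0 l, g (a + x) = ∫⁻ x in Ioc a b, g x := by
    intro g
    have := (measurePreserving_add_left volume a).setLIntegral_comp_preimage_emb
      (measurableEmbedding_addLeft a) g (Ioc a b)
    simpa [l] using this
  have cv2 : ∀ g : ℝ → ℝ≥0∞, ∫⁻ x in Ioc 0 l, g (b - x) = ∫⁻ x in Ioc a b, g x := by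
    intro g
    have := (Measure.measurePreserving_sub_left volume b).setLIntegral_comp_preimage_emb
      (Homeomorph.subLeft b).measurableEmbedding g (Ioc a b)
    rw [← this]
    simp only [preimage_const_sub_Ioc, sub_self]
    exact setLIntegral_congr Ico_ae_eq_Ioc.symm
  have h1 := enorm_average_sub_le hp hc0 hl (f := fun x => f (a + x)) (by fun_prop)
  have h2 := enorm_average_sub_le hp hc0 hl (f := fun x => f (b - x)) (by fun_prop)
  have e1 : ∫⁻ r in Ioc 0 l, ∫⁻ x in Ioc 0 l, diffQuotPow p (fun x => f (a + x)) r x = I := by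
    have : ∀ r x, diffQuotPow p (fun x => f (a + x)) r x = diffQuotPow p f (a + r) (a + x) := by
      intro r x; simp [diffQuotPow]
    simp only [this, hI]
    rw [← cv1]
    simp only [← cv1]
  have e2 : ∫⁻ r in Ioc 0 l, ∫⁻ x in Ioc 0 l, diffQuotPow p (fun x => f (b - x)) r x = I := by
    have : ∀ r x, diffQuotPow p (fun x => f (b - x)) r x = diffQuotPow p f (b - r) (b - x) := by
      intro r x
      simp only [diffQuotPow, edist_dist, Real.dist_eq]
      rw [sub_sub_sub_cancel_left, abs_sub_comm]
    simp only [this, hI]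
    rw [← cv2]
    simp only [← cv2]
  rw [e1] at h1
  rw [e2] at h2
  have a1 : ∫ x in (0 : ℝ)..l, f (a + x) = ∫ x in a..b, f x := by
    rw [intervalIntegral.integral_comp_add_left]; simp [l]
  have a2 : ∫ x in (0 : ℝ)..l, f (b - x) = ∫ x in a..b, f x := by
    rw [intervalIntegral.integral_comp_sub_left]; simp [l]
  simp only [a1, a2, add_zero, sub_zero] at h1 h2
  rcases eq_or_ne I ⊤ with hIt | hIt
  · rw [hIt, ENNReal.mul_top (by simpa using by positivity)]
    exact le_top
  have hIr : I = ENNReal.ofReal I.toReal := (ENNReal.ofReal_toReal hIt).symm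
  set J := I.toReal
  have hJ : 0 ≤ J := ENNReal.toReal_nonneg
  rw [hIr, ← ENNReal.ofReal_mul (by positivity), ← ENNReal.ofReal_add (by positivity)
    (by positivity), ← ofReal_norm, ENNReal.ofReal_le_ofReal_iff (by positivity)] at h1 h2
  rw [hIr, ← ENNReal.ofReal_mul (by positivity)]
  refine ENNReal.ofReal_le_ofReal ?_
  set m := l⁻¹ • ∫ x in a..b, f x
  have h3 : ‖f b - f a‖ ≤ ‖m - f a‖ + ‖m - f b‖ := by
    rw [norm_sub_rev m (f b), add_comm]
    exact norm_sub_le_norm_sub_add_norm_sub _ _ _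
  have h4 : c / α = η / 8 := by rw [hc]; field_simp
  have h5 : η / 2 ≤ 2 * (c ^ (1 - p) * l ^ (p - 2) * J) := by
    have : c / ((p - 2) / p) = η / 8 := h4
    rw [this] at h1 h2
    linarith
  have h6 : l ^ (2 - p) * l ^ (p - 2) = 1 := by
    rw [← Real.rpow_add hl]; simp
  have h7 : 0 < l ^ (2 - p) := by positivity
  have h8 : l ^ (2 - p) * (η / 2) ≤ 2 * c ^ (1 - p) * J := by
    calc l ^ (2 - p) * (η / 2) ≤ l ^ (2 - p) * (2 * (c ^ (1 - p) * l ^ (p - 2) * J)) := by gcongr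
      _ = 2 * c ^ (1 - p) * J * (l ^ (2 - p) * l ^ (p - 2)) := by ring
      _ = _ := by rw [h6, mul_one]
  rw [div_mul_eq_mul_div, le_div_iff₀ hη]
  linarith

end Morrey


/-! ### Double integrals, turning pairs and the energy of a turning arc. -/

section Energy

theorem setLIntegral_prod_self_le_of_le_add_swap {A : Set ℝ} (hA : MeasurableSet A)
    {F H : ℝ × ℝ → ℝ≥0∞} (hH : Measurable H) (h : ∀ z ∈ A ×ˢ A, F z ≤ H z + H z.swap) :
    ∫⁻ z in A ×ˢ A, F z ≤ 2 * ∫⁻ z in A ×ˢ A, H z := by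
  calc ∫⁻ z in A ×ˢ A, F z ≤ ∫⁻ z in A ×ˢ A, (H z + H z.swap) :=
        setLIntegral_mono' (hA.prod hA) h
    _ = (∫⁻ z in A ×ˢ A, H z) + ∫⁻ z in A ×ˢ A, H z.swap := lintegral_add_left hH _
    _ = 2 * ∫⁻ z in A ×ˢ A, H z := by
        rw [two_mul]
        congr 1
        rw [Measure.volume_eq_prod, ← Measure.prod_restrict]
        exact lintegral_prod_swap (μ := volume.restrict A) (ν := volume.restrict A) H

theorem setLIntegral_prod_eq {A B : Set ℝ} {H : ℝ × ℝ → ℝ≥0∞} (hH : Measurable H) :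
    ∫⁻ z in A ×ˢ B, H z = ∫⁻ x in A, ∫⁻ y in B, H (x, y) := by
  rw [Measure.volume_eq_prod, ← Measure.prod_restrict, lintegral_prod _ hH.aemeasurable]

theorem lintegral_Ioi_rpow_neg {q c : ℝ} (hq : 1 < q) (hc : 0 < c) :
    ∫⁻ x in Ioi c, ENNReal.ofReal (x ^ (-q)) = ENNReal.ofReal (c ^ (1 - q) / (q - 1)) := by
  rw [← ofReal_integral_eq_lintegral_ofReal (integrableOn_Ioi_rpow_of_lt (by linarith) hc),
    integral_Ioi_rpow_of_lt (by linarith) hc]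
  · congr 1
    rw [show -q + 1 = 1 - q by ring, ← neg_sub q 1, neg_div_neg_eq]
  · refine (ae_restrict_mem measurableSet_Ioi).mono fun r hr => ?_
    have : 0 < r := hc.trans hr
    simp only [Pi.zero_apply]
    positivity

theorem measurable_ofReal_abs_sub_rpow (p : ℝ) :
    Measurable fun z : ℝ × ℝ => ENNReal.ofReal (|z.1 - z.2| ^ (-p)) :=
  ENNReal.measurable_ofReal.comp
    (Measurable.pow_const (by fun_prop : Continuous fun z : ℝ × ℝ => |z.1 - z.2|).measurable _)

/-- The total weight of the pairs that jump over `[a, b]`. It has the same scaling `(b - a)^(2-p)`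
as the lower energy bound for a turning step. -/
theorem lintegral_Iic_prod_Ici_rpow {p a b : ℝ} (hp : 2 < p) (hab : a < b) :
    ∫⁻ z in Iic a ×ˢ Ici b, ENNReal.ofReal (|z.1 - z.2| ^ (-p)) =
      ENNReal.ofReal (1 / ((p - 1) * (p - 2))) * ENNReal.ofReal ((b - a) ^ (2 - p)) := by
  rw [setLIntegral_prod_eq (measurable_ofReal_abs_sub_rpow p)]
  have h1 : ∀ s ∈ Iic a, ∫⁻ t in Ici b, ENNReal.ofReal (|s - t| ^ (-p)) =
      ENNReal.ofReal (1 / (p - 1)) * ENNReal.ofReal ((b - s) ^ (-(p - 1))) := by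
    intro s hs
    have hs' : 0 < b - s := by have : s ≤ a := hs; linarith
    rw [← ENNReal.ofReal_mul (by apply one_div_nonneg.2; linarith), one_div_mul_eq_div, neg_sub,
      ← lintegral_Ioi_rpow_neg (by linarith) hs', setLIntegral_congr Ioi_ae_eq_Ici.symm]
    have := (measurePreserving_sub_right volume s).setLIntegral_comp_preimage_emb
      (measurableEmbedding_subRight s) (fun x => ENNReal.ofReal (x ^ (-p))) (Ioi (b - s))
    rw [← this]
    simp only [preimage_sub_const_Ioi, sub_add_cancel]
    refine setLIntegral_congr_fun measurableSet_Ioi fun t ht => ?_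
    have : b < t := ht
    rw [abs_sub_comm, abs_of_pos (by linarith)]
  rw [setLIntegral_congr_fun measurableSet_Iic h1, lintegral_const_mul _ (by fun_prop)]
  have hpos : 0 < b - a := sub_pos.2 hab
  have h2 : ∫⁻ s in Iic a, ENNReal.ofReal ((b - s) ^ (-(p - 1))) =
      ENNReal.ofReal ((b - a) ^ (1 - (p - 1)) / ((p - 1) - 1)) := by
    rw [← lintegral_Ioi_rpow_neg (by linarith) hpos,
      setLIntegral_congr (Ioi_ae_eq_Ici (a := b - a))]
    have := (Measure.measurePreserving_sub_left volume b).setLIntegral_comp_preimage_emb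
      (Homeomorph.subLeft b).measurableEmbedding (fun x => ENNReal.ofReal (x ^ (-(p - 1))))
      (Ici (b - a))
    rw [← this]
    simp
  rw [h2, ← ENNReal.ofReal_mul (by apply one_div_nonneg.2; linarith),
    ← ENNReal.ofReal_mul (by apply one_div_nonneg.2; nlinarith)]
  congr 1
  rw [show 1 - (p - 1) = 2 - p by ring, show p - 1 - 1 = p - 2 by ring]
  have : p - 1 ≠ 0 := by linarith
  have : p - 2 ≠ 0 := by linarith
  field_simp

variable {E : Type} [NormedAddCommGroup E]

/-- The pairs of parameters between which the tangent turns by more than `1`. -/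
def turningPairs (v : ℝ → E) : Set (ℝ × ℝ) :=
  {z | ∃ u ∈ uIcc z.1 z.2, ∃ u' ∈ uIcc z.1 z.2, 1 < ‖v u - v u'‖}

theorem isOpen_turningPairs {v : ℝ → E} (hv : Continuous v) : IsOpen (turningPairs v) := by
  -- Intermediate parameters at fixed affine ratios depend continuously on the pair, so each set of
  -- the union is open.
  have : turningPairs v = ⋃ q ∈ Icc (0 : ℝ) 1 ×ˢ Icc (0 : ℝ) 1, {z : ℝ × ℝ |
      1 < ‖v (z.1 + q.1 • (z.2 - z.1)) - v (z.1 + q.2 • (z.2 - z.1))‖} := by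
    ext z
    simp only [turningPairs, ← segment_eq_uIcc, segment_eq_image', mem_ofPred_eq,
      exists_mem_image, mem_iUnion, mem_prod, exists_prop, Prod.exists]
    constructor
    · rintro ⟨a, ha, b, hb, h⟩
      exact ⟨a, b, ⟨ha, hb⟩, h⟩
    · rintro ⟨a, b, ⟨ha, hb⟩, h⟩
      exact ⟨a, ha, b, hb, h⟩
  rw [this]
  exact isOpen_biUnion fun q _ => isOpen_lt continuous_const (by fun_prop)

variable [InnerProductSpace ℝ E]

/-- The integrand of the tangent-point energy of the curve `G` with unit tangent `v`, where `s` is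
the parameter of the point of tangency. -/
def tangentPointDensity (p : ℝ) (G v : ℝ → E) (t s : ℝ) : ℝ≥0∞ :=
  ENNReal.ofReal (tangentPointCurvature (G s) (v s) (G t)) ^ p

theorem measurable_tangentPointDensity (p : ℝ) {G v : ℝ → E} (hG : Continuous G)
    (hv : Continuous v) :
    Measurable fun z : ℝ × ℝ => tangentPointDensity p G v z.1 z.2 := by
  unfold tangentPointDensity tangentPointCurvature
  refine Measurable.pow_const (ENNReal.measurable_ofReal.comp (Measurable.div ?_ ?_)) p
  · exact (by fun_prop : Continuous fun z : ℝ × ℝ => 2 * ‖G z.1 - G z.2 -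
      inner ℝ (v z.2) (G z.1 - G z.2) • v z.2‖).measurable
  · exact (by fun_prop : Continuous fun z : ℝ × ℝ => ‖G z.1 - G z.2‖ ^ 2).measurable

theorem diffQuotPow_le_tangentPointDensity {p : ℝ} (hp : 1 ≤ p) {G v : ℝ → E}
    (hG : ∀ s, HasDerivAt G (v s) s) (hu : ∀ s, ‖v s‖ = 1) {s t : ℝ}
    (hosc : ∀ u ∈ uIcc s t, ∀ u' ∈ uIcc s t, ‖v u - v u'‖ ≤ 1) :
    diffQuotPow p v s t ≤ 2 ^ (p - 1) * tangentPointDensity p G v s t +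
      2 ^ (p - 1) * tangentPointDensity p G v t s := by
  rw [← mul_add]
  refine le_trans ?_ (ENNReal.rpow_add_le_mul_rpow_add_rpow _ _ hp)
  unfold diffQuotPow
  refine ENNReal.rpow_le_rpow ?_ (by linarith)
  refine ENNReal.div_le_of_le_mul ?_
  rw [← ENNReal.ofReal_add (tangentPointCurvature_nonneg _ _ _)
    (tangentPointCurvature_nonneg _ _ _), edist_dist, Real.dist_eq, ← ofReal_norm,
    ← ENNReal.ofReal_mul (add_nonneg (tangentPointCurvature_nonneg _ _ _)
      (tangentPointCurvature_nonneg _ _ _))]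
  refine ENNReal.ofReal_le_ofReal ?_
  rw [mul_comm, add_comm]
  exact norm_deriv_sub_le_of_osc_le hG hu hosc

theorem two_mul_two_rpow_sub_one (p : ℝ) : (2 : ℝ≥0∞) * 2 ^ (p - 1) = 2 ^ p := by
  nth_rw 1 [← ENNReal.rpow_one 2]
  rw [← ENNReal.rpow_add _ _ (by simp) (by simp)]
  congr 1
  ring

/-- An interval on which the tangent turns by `η`, but by at most `1`, carries a definite amount of
energy. -/
theorem exists_rpow_le_lintegral_tangentPointDensity {p η : ℝ} (hp : 2 < p) (hη : 0 < η) :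
    ∃ C : ℝ, 0 < C ∧ ∀ {E : Type} [NormedAddCommGroup E] [InnerProductSpace ℝ E] [CompleteSpace E]
      (G v : ℝ → E) (a b : ℝ), Continuous v → (∀ s, HasDerivAt G (v s) s) → (∀ s, ‖v s‖ = 1) →
        a < b → η ≤ ‖v b - v a‖ → (∀ u ∈ Icc a b, ∀ u' ∈ Icc a b, ‖v u - v u'‖ ≤ 1) →
        ENNReal.ofReal ((b - a) ^ (2 - p)) ≤
          ENNReal.ofReal C * ∫⁻ z in Ioc a b ×ˢ Ioc a b, tangentPointDensity p G v z.1 z.2 := by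
  obtain ⟨C, hC, h⟩ := exists_rpow_le_lintegral_diffQuotPow hp hη
  refine ⟨C * 2 ^ p, by positivity, ?_⟩
  intro E _ _ _ G v a b hv hG hu hab hosc1 hosc
  have hGc : Continuous G := continuous_iff_continuousAt.2 fun s => (hG s).continuousAt
  have hD := measurable_tangentPointDensity p hGc hv
  refine (h v a b hv hab hosc1).trans ?_
  rw [ENNReal.ofReal_mul hC.le, mul_assoc]
  gcongr
  rw [← setLIntegral_prod_eq (measurable_diffQuotPow p hv)]
  refine (setLIntegral_prod_self_le_of_le_add_swap measurableSet_Ioc (hD.const_mul (2 ^ (p - 1)))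
    fun z hz => ?_).trans_eq ?_
  · refine diffQuotPow_le_tangentPointDensity (by linarith) hG hu fun u hu u' hu' => ?_
    have hsub : uIcc z.1 z.2 ⊆ Icc a b :=
      uIcc_subset_Icc (Ioc_subset_Icc_self hz.1) (Ioc_subset_Icc_self hz.2)
    exact hosc u (hsub hu) u' (hsub hu')
  · rw [lintegral_const_mul _ hD, ← mul_assoc, two_mul_two_rpow_sub_one,
      ← ENNReal.ofReal_rpow_of_nonneg (by norm_num) (by linarith), ENNReal.ofReal_ofNat]

end Energy


/-! ### Greedy decomposition into steps of turning `1/4`. -/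

section Turning

variable {E : Type} [NormedAddCommGroup E]

/-- `b` is the first parameter after `a` at which the tangent has turned by `1 / 4`. -/
structure IsTurningStep (v : ℝ → E) (L a b : ℝ) : Prop where
  lt : a < b
  le : b ≤ L
  quarter_le : 1 / 4 ≤ ‖v b - v a‖
  le_quarter : ∀ u ∈ Icc a b, ‖v u - v a‖ ≤ 1 / 4

theorem exists_isTurningStep {v : ℝ → E} (hv : Continuous v) {L a u : ℝ} (hu : u ∈ Icc a L)
    (h : 1 / 4 < ‖v u - v a‖) : ∃ b, IsTurningStep v L a b := by
  set Z := {u ∈ Icc a L | 1 / 4 ≤ ‖v u - v a‖} with hZ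
  have hZc : IsCompact Z := isCompact_Icc.inter_right
    (isClosed_le continuous_const (by fun_prop : Continuous fun u => ‖v u - v a‖))
  obtain ⟨b, hb, hmin⟩ := hZc.exists_isLeast ⟨u, hu, h.le⟩
  have hab : a < b := by
    refine lt_of_le_of_ne hb.1.1 ?_
    rintro rfl
    have := hb.2
    norm_num at this
  refine ⟨b, hab, hb.1.2, hb.2, ?_⟩
  have hlt : ∀ x ∈ Ico a b, ‖v x - v a‖ ≤ 1 / 4 := by
    intro x hx
    by_contra hcon
    have := hmin ⟨⟨hx.1, hx.2.le.trans hb.1.2⟩, (not_le.1 hcon).le⟩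
    exact absurd hx.2 (not_lt.2 this)
  have hcl : IsClosed {x | ‖v x - v a‖ ≤ 1 / 4} :=
    isClosed_le (by fun_prop : Continuous fun u => ‖v u - v a‖) continuous_const
  have := closure_minimal (s := Ico a b) (fun x hx => hlt x hx) hcl
  rw [closure_Ico hab.ne] at this
  exact fun x hx => this hx

/-- The turning pairs with both parameters in `(a, L]`, the smaller one first. -/
def turningPairsAbove (v : ℝ → E) (L a : ℝ) : Set (ℝ × ℝ) :=
  turningPairs v ∩ {z | a < z.1 ∧ z.1 ≤ z.2 ∧ z.2 ≤ L}

theorem measurableSet_turningPairsAbove {v : ℝ → E} (hv : Continuous v) (L a : ℝ) :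
    MeasurableSet (turningPairsAbove v L a) :=
  (isOpen_turningPairs hv).measurableSet.inter
    ((measurableSet_lt measurable_const measurable_fst).inter
      ((measurableSet_le measurable_fst measurable_snd).inter
        (measurableSet_le measurable_snd measurable_const)))

theorem turningPairsAbove_eq_empty {v : ℝ → E} {L a : ℝ} {w : E}
    (h : ∀ u ∈ Icc a L, ‖v u - w‖ ≤ 1 / 2) : turningPairsAbove v L a = ∅ := by
  rw [eq_empty_iff_forall_notMem]
  rintro ⟨s, t⟩ ⟨⟨u, hu, u', hu', hlt⟩, h1, h2, h3⟩
  simp only at *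
  rw [uIcc_of_le h2] at hu hu'
  have hA := h u ⟨by linarith [hu.1], by linarith [hu.2]⟩
  have hB := h u' ⟨by linarith [hu'.1], by linarith [hu'.2]⟩
  have := norm_sub_le_norm_sub_add_norm_sub (v u) w (v u')
  rw [norm_sub_rev w] at this
  linarith

theorem IsTurningStep.norm_sub_le_half {v : ℝ → E} {L a b : ℝ} (hab : IsTurningStep v L a b)
    {c : ℝ} (h : ∀ u ∈ Icc b c, ‖v u - v b‖ ≤ 1 / 4) : ∀ u ∈ Icc a c, ‖v u - v a‖ ≤ 1 / 2 := by
  intro u hu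
  rcases le_total u b with hub | hub
  · linarith [hab.le_quarter u ⟨hu.1, hub⟩]
  · have := norm_sub_le_norm_sub_add_norm_sub (v u) (v b) (v a)
    linarith [hab.le_quarter b ⟨hab.lt.le, le_rfl⟩, h u ⟨hub, hu.2⟩]

/-- On two consecutive steps the tangent stays within `1/2` of `v a`, so no pair inside them turns
by more than `1`. A turning pair that starts in the first step must therefore end after the second.
-/
theorem turningPairsAbove_subset {v : ℝ → E} {L a b c : ℝ} (hab : IsTurningStep v L a b)
    (hbc : IsTurningStep v L b c) :
    turningPairsAbove v L a ⊆ turningPairsAbove v L b ∪ Iic b ×ˢ Ici c := by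
  rintro ⟨s, t⟩ ⟨hz, h1, h2, h3⟩
  rcases lt_or_ge b s with hs | hs
  · exact Or.inl ⟨hz, hs, h2, h3⟩
  rcases le_or_gt c t with ht | ht
  · exact Or.inr ⟨hs, ht⟩
  have := turningPairsAbove_eq_empty (v := v) (hab.norm_sub_le_half hbc.le_quarter)
  exact absurd (show (s, t) ∈ turningPairsAbove v c a from ⟨hz, h1, h2, ht.le⟩) (by simp [this])

end Turning

/-! ### The seminorm of the tangent is bounded by the energy. -/

section Gagliardo

theorem exists_lintegral_turningPairsAbove_le {p : ℝ} (hp : 2 < p) :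
    ∃ C : ℝ, 0 < C ∧ ∀ {E : Type} [NormedAddCommGroup E] [InnerProductSpace ℝ E] [CompleteSpace E]
      (G v : ℝ → E) (L : ℝ), Continuous v → (∀ s, HasDerivAt G (v s) s) → (∀ s, ‖v s‖ = 1) →
        ∫⁻ z in turningPairsAbove v L 0, ENNReal.ofReal (|z.1 - z.2| ^ (-p)) ≤
          ENNReal.ofReal C * ∫⁻ z in Ioc 0 L ×ˢ Ioc 0 L, tangentPointDensity p G v z.1 z.2 := by
  obtain ⟨C, hC, hMorrey⟩ := exists_rpow_le_lintegral_tangentPointDensity (η := 1 / 4) hp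
    (by norm_num)
  have hB0 : 0 < 1 / ((p - 1) * (p - 2)) :=
    one_div_pos.2 (mul_pos (by linarith) (by linarith))
  set B := 1 / ((p - 1) * (p - 2)) with hB
  refine ⟨B * C, by positivity, ?_⟩
  intro E _ _ _ G v L hv hG hu
  set D := fun z : ℝ × ℝ => tangentPointDensity p G v z.1 z.2
  set R := fun z : ℝ × ℝ => ENNReal.ofReal (|z.1 - z.2| ^ (-p))
  have huc : UniformContinuousOn v (Icc 0 L) :=
    isCompact_Icc.uniformContinuousOn_of_continuous hv.continuousOn
  obtain ⟨δ, hδ, hδv⟩ := Metric.uniformContinuousOn_iff.1 huc (1 / 4) (by norm_num)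
  -- Induction from the right end. The extra term is the weight of all pairs that jump over `[a,
  -- b]`; it is reserved for the step that precedes `a`.
  have key : ∀ n : ℕ, ∀ a b : ℝ, 0 ≤ a → L - a ≤ n * δ → IsTurningStep v L a b →
      (∫⁻ z in turningPairsAbove v L a, R z)
        + ENNReal.ofReal B * ENNReal.ofReal ((b - a) ^ (2 - p)) ≤
        ENNReal.ofReal (B * C) * ∫⁻ z in Ioc a L ×ˢ Ioc a L, D z := by
    intro n
    induction n with
    | zero =>
      intro a b _ h hab
      have h1 := hab.lt
      have h2 := hab.le
      simp at h
      linarith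
    | succ n ih =>
      intro a b ha h hab
      -- By uniform continuity every step has length at least `δ`, so the induction on `n`
      -- terminates.
      have hba : δ ≤ b - a := by
        by_contra hcon
        have h1 := hδv b ⟨ha.trans hab.lt.le, hab.le⟩ a ⟨ha, hab.lt.le.trans hab.le⟩ (by
          rw [Real.dist_eq, abs_of_pos (sub_pos.2 hab.lt)]; exact not_le.1 hcon)
        rw [dist_eq_norm] at h1
        exact absurd h1 (not_lt.2 hab.quarter_le)
      have hfar : ENNReal.ofReal B * ENNReal.ofReal ((b - a) ^ (2 - p)) ≤
          ENNReal.ofReal (B * C) * ∫⁻ z in Ioc a b ×ˢ Ioc a b, D z := by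
        rw [ENNReal.ofReal_mul hB0.le, mul_assoc]
        gcongr
        refine hMorrey G v a b hv hG hu hab.lt hab.quarter_le fun u hu u' hu' => ?_
        have := norm_sub_le_norm_sub_add_norm_sub (v u) (v a) (v u')
        rw [norm_sub_rev (v a)] at this
        linarith [hab.le_quarter u hu, hab.le_quarter u' hu']
      have hdisj : Disjoint (Ioc a b ×ˢ Ioc a b) (Ioc b L ×ˢ Ioc b L) := by
        rw [disjoint_left]
        rintro ⟨s, t⟩ h1 h2
        exact absurd h1.1.2 (not_le.2 h2.1.1)
      have hadd : (∫⁻ z in Ioc a b ×ˢ Ioc a b, D z) + ∫⁻ z in Ioc b L ×ˢ Ioc b L, D z ≤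
          ∫⁻ z in Ioc a L ×ˢ Ioc a L, D z := by
        rw [← lintegral_union (measurableSet_Ioc.prod measurableSet_Ioc) hdisj]
        refine lintegral_mono_set (union_subset ?_ ?_)
        · exact prod_mono (Ioc_subset_Ioc_right hab.le) (Ioc_subset_Ioc_right hab.le)
        · exact prod_mono (Ioc_subset_Ioc_left hab.lt.le) (Ioc_subset_Ioc_left hab.lt.le)
      by_cases hex : ∃ c, IsTurningStep v L b c
      · obtain ⟨c, hbc⟩ := hex
        have h1 := ih b c (ha.trans hab.lt.le) (by push_cast at h; linarith) hbc
        have h2 : ∫⁻ z in turningPairsAbove v L a, R z ≤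
            (∫⁻ z in turningPairsAbove v L b, R z) +
              ENNReal.ofReal B * ENNReal.ofReal ((c - b) ^ (2 - p)) := by
          rw [← lintegral_Iic_prod_Ici_rpow hp hbc.lt]
          exact (lintegral_mono_set (turningPairsAbove_subset hab hbc)).trans
            (lintegral_union_le _ _ _)
        calc _ ≤ ENNReal.ofReal (B * C) * (∫⁻ z in Ioc b L ×ˢ Ioc b L, D z) +
              ENNReal.ofReal (B * C) * ∫⁻ z in Ioc a b ×ˢ Ioc a b, D z :=
              add_le_add (h2.trans h1) hfar
          _ ≤ _ := by
              rw [← mul_add, add_comm]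
              gcongr
      · have hno : ∀ u ∈ Icc b L, ‖v u - v b‖ ≤ 1 / 4 := by
          intro u hu
          by_contra hcon
          exact hex (exists_isTurningStep hv hu (not_le.1 hcon))
        rw [turningPairsAbove_eq_empty (hab.norm_sub_le_half hno)]
        simp only [Measure.restrict_empty, lintegral_zero_measure, zero_add]
        exact hfar.trans (mul_le_mul' le_rfl (le_trans le_self_add hadd))
  by_cases hex : ∃ b, IsTurningStep v L 0 b
  · obtain ⟨b, hb⟩ := hex
    obtain ⟨n, hn⟩ := exists_nat_ge (L / δ)
    refine le_trans le_self_add (key n 0 b le_rfl ?_ hb)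
    rw [sub_zero]
    exact (div_le_iff₀ hδ).1 hn
  · rw [turningPairsAbove_eq_empty (w := v 0)]
    · simp
    · intro u hu
      by_contra hcon
      exact hex (exists_isTurningStep hv hu (by linarith [not_le.1 hcon]))

/-- The seminorm of the unit tangent is bounded by a multiple of the energy. -/
theorem exists_lintegral_diffQuotPow_le {p : ℝ} (hp : 2 < p) :
    ∃ C : ℝ, 0 < C ∧ ∀ {E : Type} [NormedAddCommGroup E] [InnerProductSpace ℝ E] [CompleteSpace E]
      (G v : ℝ → E) (L : ℝ), Continuous v → (∀ s, HasDerivAt G (v s) s) → (∀ s, ‖v s‖ = 1) →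
        ∫⁻ x in Ioc 0 L, ∫⁻ y in Ioc 0 L, diffQuotPow p v x y ≤
          ENNReal.ofReal C * ∫⁻ x in Ioc 0 L, ∫⁻ y in Ioc 0 L, tangentPointDensity p G v x y := by
  obtain ⟨C, hC, hbad⟩ := exists_lintegral_turningPairsAbove_le hp
  refine ⟨2 * (2 ^ (p - 1) + 2 ^ p * C), by positivity, ?_⟩
  intro E _ _ _ G v L hv hG hu
  have hGc : Continuous G := continuous_iff_continuousAt.2 fun s => (hG s).continuousAt
  have hD := measurable_tangentPointDensity p hGc hv
  rw [← setLIntegral_prod_eq hD, ← setLIntegral_prod_eq (measurable_diffQuotPow p hv)]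
  set D := fun z : ℝ × ℝ => tangentPointDensity p G v z.1 z.2
  set T := turningPairsAbove v L 0
  have hT : MeasurableSet T := measurableSet_turningPairsAbove hv L 0
  set R := fun z : ℝ × ℝ => ENNReal.ofReal (|z.1 - z.2| ^ (-p))
  have hR : Measurable R := measurable_ofReal_abs_sub_rpow p
  have hp0 : 0 < p := by linarith
  have hfar : ∀ x y : ℝ, diffQuotPow p v x y ≤ 2 ^ p * R (x, y) := by
    intro x y
    rcases eq_or_ne x y with rfl | hne
    · simp [diffQuotPow, hp0]
    have h2 : ‖v x - v y‖ ≤ 2 := by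
      have := norm_sub_le (v x) (v y)
      rw [hu, hu] at this
      linarith
    have hpos : 0 < |x - y| := abs_pos.2 (sub_ne_zero.2 hne)
    rw [diffQuotPow_eq_ofReal hp0.le v hne]
    have e : (2 : ℝ≥0∞) ^ p = ENNReal.ofReal (2 ^ p) := by
      rw [← ENNReal.ofReal_rpow_of_nonneg (by norm_num) hp0.le, ENNReal.ofReal_ofNat]
    rw [e, ← ENNReal.ofReal_mul (by positivity)]
    refine ENNReal.ofReal_le_ofReal ?_
    rw [Real.div_rpow (norm_nonneg _) hpos.le, Real.rpow_neg hpos.le, div_eq_mul_inv]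
    gcongr
  -- `T` contains only ordered pairs, and the density singles out one point of tangency; adding the
  -- swapped majorant covers the other order and the other tangency.
  refine (setLIntegral_prod_self_le_of_le_add_swap measurableSet_Ioc
    (H := fun z => 2 ^ (p - 1) * D z + T.indicator (fun z => 2 ^ p * R z) z)
    ((hD.const_mul _).add ((hR.const_mul _).indicator hT)) ?_).trans ?_
  · rintro ⟨x, y⟩ ⟨hx, hy⟩
    by_cases hbp : (x, y) ∈ turningPairs v
    · rcases le_total x y with hxy | hxy
      · have hm : (x, y) ∈ T := ⟨hbp, hx.1, hxy, hy.2⟩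
        refine le_trans ?_ le_self_add
        refine le_trans ?_ le_add_self
        rw [indicator_of_mem hm]
        exact hfar x y
      · have hm : (x, y).swap ∈ T := by
          refine ⟨?_, hy.1, hxy, hx.2⟩
          obtain ⟨u, hu, u', hu', h⟩ := hbp
          exact ⟨u, by rwa [uIcc_comm] at hu, u', by rwa [uIcc_comm] at hu', h⟩
        refine le_trans ?_ le_add_self
        refine le_trans ?_ le_add_self
        rw [indicator_of_mem hm, diffQuotPow_comm]
        exact hfar y x
    · have hosc : ∀ u ∈ uIcc x y, ∀ u' ∈ uIcc x y, ‖v u - v u'‖ ≤ 1 := by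
        intro u hu u' hu'
        by_contra hcon
        exact hbp ⟨u, hu, u', hu', not_le.1 hcon⟩
      refine (diffQuotPow_le_tangentPointDensity (by linarith) hG hu hosc).trans ?_
      exact add_le_add le_self_add le_self_add
  · have h1 : ∫⁻ z in Ioc 0 L ×ˢ Ioc 0 L, T.indicator (fun z => 2 ^ p * R z) z ≤
        2 ^ p * (ENNReal.ofReal C * ∫⁻ z in Ioc 0 L ×ˢ Ioc 0 L, D z) := by
      calc _ ≤ ∫⁻ z, T.indicator (fun z => 2 ^ p * R z) z := setLIntegral_le_lintegral _ _
        _ = 2 ^ p * ∫⁻ z in T, R z := by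
            rw [lintegral_indicator hT, lintegral_const_mul _ hR]
        _ ≤ _ := by
            gcongr
            exact hbad G v L hv hG hu
    rw [lintegral_add_left (hD.const_mul _), lintegral_const_mul _ hD]
    calc _ ≤ 2 * (2 ^ (p - 1) * (∫⁻ z in Ioc 0 L ×ˢ Ioc 0 L, D z) +
          2 ^ p * (ENNReal.ofReal C * ∫⁻ z in Ioc 0 L ×ˢ Ioc 0 L, D z)) := by gcongr
      _ = _ := by
        rw [ENNReal.ofReal_mul (by norm_num), ENNReal.ofReal_add (by positivity) (by positivity),
          ENNReal.ofReal_mul (by positivity), ← ENNReal.ofReal_rpow_of_pos (by norm_num),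
          ← ENNReal.ofReal_rpow_of_pos (by norm_num), ENNReal.ofReal_ofNat]
        ring

end Gagliardo


/-! ### Extension of the curve to the line, and its weak derivative. -/

section Extension

variable {d : ℕ} {L : ℝ} {γ : ℝ → EuclideanSpace ℝ (Fin d)}

/-- A `C¹` curve on `[0, L]` that is parametrized by arc length extends to the real line. -/
theorem exists_unit_speed_extension (hL : 0 < L) (hγ : ContDiffOn ℝ 1 γ (Icc 0 L))
    (hu : ∀ s ∈ Icc 0 L, ‖curveDeriv L γ s‖ = 1) :
    ∃ G v : ℝ → EuclideanSpace ℝ (Fin d), Continuous v ∧ (∀ s, HasDerivAt G (v s) s) ∧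
      (∀ s, ‖v s‖ = 1) ∧ EqOn G γ (Icc 0 L) ∧ EqOn v (curveDeriv L γ) (Icc 0 L) := by
  have hc : ContinuousOn (curveDeriv L γ) (Icc 0 L) :=
    hγ.continuousOn_derivWithin (uniqueDiffOn_Icc hL) le_rfl
  -- The tangent is continued by its end values, so the curve is continued by straight rays.
  set v : ℝ → EuclideanSpace ℝ (Fin d) := fun s => curveDeriv L γ (projIcc 0 L hL.le s) with hvdef
  have hv : Continuous v :=
    hc.comp_continuous (continuous_subtype_val.comp continuous_projIcc) fun s => (projIcc 0 L _ s).2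
  have hveq : EqOn v (curveDeriv L γ) (Icc 0 L) := by
    intro s hs
    simp only [hvdef]
    rw [projIcc_of_mem hL.le hs]
  refine ⟨fun s => γ 0 + ∫ u in (0 : ℝ)..s, v u, v, hv, fun s => ?_, fun s => ?_, ?_, hveq⟩
  · exact (intervalIntegral.integral_hasDerivAt_right (hv.intervalIntegrable _ _)
      (hv.stronglyMeasurableAtFilter _ _) hv.continuousAt).const_add _
  · exact hu _ (projIcc 0 L _ s).2
  · intro s hs
    have : ∫ u in (0 : ℝ)..s, v u = γ s - γ 0 := by
      refine intervalIntegral.integral_eq_sub_of_hasDerivAt_of_le hs.1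
        (hγ.continuousOn.mono (Icc_subset_Icc_right hs.2)) (fun u hu' => ?_)
        (hv.intervalIntegrable _ _)
      have hu1 : u ∈ Ioo 0 L := ⟨hu'.1, hu'.2.trans_le hs.2⟩
      rw [hveq (Ioo_subset_Icc_self hu1)]
      have hd := (hγ.differentiableOn one_ne_zero u (Ioo_subset_Icc_self hu1)).hasDerivWithinAt
      exact hd.hasDerivAt (Icc_mem_nhds hu1.1 hu1.2)
    simp only [this]
    abel

theorem lintegral_tangentPointDensity_le {p : ℝ} (hp : 0 ≤ p) {G v : ℝ → EuclideanSpace ℝ (Fin d)}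
    (hu : ∀ s, ‖v s‖ = 1) (hG : EqOn G γ (Icc 0 L)) (hv : EqOn v (curveDeriv L γ) (Icc 0 L)) :
    ∫⁻ t in Icc 0 L, ∫⁻ s in Icc 0 L, tangentPointDensity p G v t s ≤
      tangentPointEnergy p L γ := by
  unfold tangentPointEnergy
  refine setLIntegral_mono' measurableSet_Icc fun t ht =>
    setLIntegral_mono' measurableSet_Icc fun s hs => ?_
  rw [← hv hs, ← hv ht, ← hG hs, ← hG ht, ← ofReal_norm, ← ofReal_norm, hu, hu,
    ENNReal.ofReal_one, one_mul, one_div, ← ENNReal.inv_rpow]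
  exact ENNReal.rpow_le_rpow (ofReal_tangentPointCurvature_le (hu s)) hp

theorem gagliardoPow_eq_lintegral_diffQuotPow {p : ℝ} (hp : 0 < p)
    {v w : ℝ → EuclideanSpace ℝ (Fin d)} (hv : EqOn v w (Icc 0 L)) :
    gagliardoPow (1 - 1 / p) p (Ioo 0 L) w =
      ∫⁻ y in Ioc 0 L, ∫⁻ x in Ioc 0 L, diffQuotPow p v y x := by
  unfold gagliardoPow
  rw [← setLIntegral_congr (Ioo_ae_eq_Ioc (a := (0 : ℝ)) (b := L))]
  refine setLIntegral_congr_fun measurableSet_Ioo fun y hy => ?_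
  rw [← setLIntegral_congr (Ioo_ae_eq_Ioc (a := (0 : ℝ)) (b := L))]
  refine setLIntegral_congr_fun measurableSet_Ioo fun x hx => ?_
  rw [diffQuotPow_comm, diffQuotPow, ENNReal.div_rpow_of_nonneg _ _ hp.le,
    hv (Ioo_subset_Icc_self hx), hv (Ioo_subset_Icc_self hy)]
  -- The Gagliardo exponent `1 + (1 - 1/p) p` equals `p`.
  congr 2
  field_simp
  ring

theorem hasWeakDeriv_of_hasDerivAt {G v g w : ℝ → EuclideanSpace ℝ (Fin d)} (hvc : Continuous v)
    (hd : ∀ s, HasDerivAt G (v s) s) (hL : 0 < L) (hG : EqOn G g (Icc 0 L))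
    (hv : EqOn v w (Icc 0 L)) : HasWeakDeriv (Ioo 0 L) g w := by
  have hGc : Continuous G := continuous_iff_continuousAt.2 fun s => (hd s).continuousAt
  refine ⟨?_, ?_, ?_⟩
  · refine ContinuousOn.locallyIntegrableOn (hGc.continuousOn.congr fun s hs => ?_)
      measurableSet_Ioo
    exact (hG (Ioo_subset_Icc_self hs)).symm
  · refine ContinuousOn.locallyIntegrableOn (hvc.continuousOn.congr fun s hs => ?_)
      measurableSet_Ioo
    exact (hv (Ioo_subset_Icc_self hs)).symm
  · intro φ hφ _ hsupp
    have hφ0 : φ 0 = 0 := image_eq_zero_of_notMem_tsupport fun h => absurd (hsupp h).1 (lt_irrefl _)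
    have hφL : φ L = 0 := image_eq_zero_of_notMem_tsupport fun h => absurd (hsupp h).2 (lt_irrefl _)
    have hφd : ∀ x, HasDerivAt φ (deriv φ x) x := fun x =>
      (hφ.differentiable (by simp) x).hasDerivAt
    have hφc : Continuous (deriv φ) := hφ.continuous_deriv (by simp)
    have h1 : ∫ x in Ioo 0 L, deriv φ x • g x = ∫ x in (0 : ℝ)..L, deriv φ x • G x := by
      rw [intervalIntegral.integral_of_le hL.le, ← integral_Ioc_eq_integral_Ioo]
      refine setIntegral_congr_fun measurableSet_Ioc fun x hx => ?_
      simp only [hG (Ioc_subset_Icc_self hx)]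
    have h2 : ∫ x in Ioo 0 L, φ x • w x = ∫ x in (0 : ℝ)..L, φ x • v x := by
      rw [intervalIntegral.integral_of_le hL.le, ← integral_Ioc_eq_integral_Ioo]
      refine setIntegral_congr_fun measurableSet_Ioc fun x hx => ?_
      simp only [hv (Ioc_subset_Icc_self hx)]
    have i1 : Continuous fun x => deriv φ x • G x := hφc.smul hGc
    have i2 : Continuous fun x => φ x • v x := hφ.continuous.smul hvc
    have h3 : ∫ x in (0 : ℝ)..L, (φ x • v x + deriv φ x • G x) = φ L • G L - φ 0 • G 0 :=
      intervalIntegral.integral_eq_sub_of_hasDerivAt (f := fun x => φ x • G x)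
        (fun x _ => (hφd x).smul (hd x)) ((i2.add i1).intervalIntegrable _ _)
    rw [intervalIntegral.integral_add (i2.intervalIntegrable _ _) (i1.intervalIntegrable _ _),
      hφ0, hφL, zero_smul, zero_smul, sub_zero] at h3
    rw [h1, h2]
    exact eq_neg_of_add_eq_zero_right h3

theorem memLp_Ioo_of_eqOn {G g : ℝ → EuclideanSpace ℝ (Fin d)} (hGc : Continuous G)
    (hG : EqOn G g (Icc 0 L)) (q : ℝ≥0∞) : MemLp g q (volume.restrict (Ioo 0 L)) := by
  obtain ⟨C, hC⟩ := (isCompact_Icc (a := (0 : ℝ)) (b := L)).exists_bound_of_continuousOn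
    hGc.continuousOn
  have h : MemLp G q (volume.restrict (Ioo 0 L)) :=
    MemLp.of_bound hGc.aestronglyMeasurable C
      ((ae_restrict_mem measurableSet_Ioo).mono fun x hx => hC x (Ioo_subset_Icc_self hx))
  refine (memLp_congr_ae ?_).1 h
  exact (ae_restrict_mem measurableSet_Ioo).mono fun x hx => hG (Ioo_subset_Icc_self hx)

end Extension


/-! ### Self-contact and divergence of the energy. -/

section SelfContact

variable {E : Type} [NormedAddCommGroup E] [InnerProductSpace ℝ E]

/-- The lower bound at a foot point `z` with tangent `σ` survives small changes of base point and
tangent: these cost at most `c r / 2` of the normal component, which is at least `c r` minus that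
loss. -/
theorem le_tangentPointCurvature {x y z τ σ : E} {c r : ℝ} (hτ : ‖τ‖ = 1)
    (hc : 0 < c) (hr : 0 < r) (hyz : ‖y - z‖ = r) (hin : |inner ℝ σ (y - z)| ≤ (1 - c) * r)
    (hστ : ‖τ - σ‖ ≤ c / 4) (hxz : ‖x - z‖ ≤ c * r / 8) (hc1 : c ≤ 1) :
    c / (4 * r) ≤ tangentPointCurvature x τ y := by
  set w := y - x with hw
  have hwz : w = (y - z) - (x - z) := by simp [hw]
  have h1 : r - c * r / 8 ≤ ‖w‖ := by
    rw [hwz, ← hyz]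
    have := norm_sub_norm_le (y - z) (x - z)
    rw [hyz] at *
    linarith
  have h2 : ‖w‖ ≤ 2 * r := by
    rw [hwz]
    have := norm_sub_le (y - z) (x - z)
    rw [hyz] at this
    nlinarith
  have h3 : |inner ℝ τ w| ≤ (1 - c) * r + c / 4 * r + c * r / 8 := by
    have e : inner ℝ τ w = inner ℝ σ (y - z) + inner ℝ (τ - σ) (y - z) - inner ℝ τ (x - z) := by
      rw [hwz, inner_sub_right, inner_sub_left]; ring
    have h4 : |inner ℝ (τ - σ) (y - z)| ≤ c / 4 * r := by
      refine (abs_real_inner_le_norm _ _).trans ?_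
      rw [hyz]; gcongr
    have h5 : |inner ℝ τ (x - z)| ≤ c * r / 8 := by
      refine (abs_real_inner_le_norm _ _).trans ?_
      rw [hτ, one_mul]; exact hxz
    rw [e]
    rw [abs_le] at *
    constructor <;> linarith [hin.1, hin.2, h4.1, h4.2, h5.1, h5.2]
  have h6 : c * r / 2 ≤ ‖w - inner ℝ τ w • τ‖ := by
    have := norm_sub_norm_le w (inner ℝ τ w • τ)
    rw [norm_smul, hτ, mul_one, Real.norm_eq_abs] at this
    linarith
  have hw0 : 0 < ‖w‖ := by nlinarith
  unfold tangentPointCurvature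
  rw [← hw, div_le_div_iff₀ (by positivity) (by positivity)]
  have h7 : ‖w‖ ^ 2 ≤ 4 * r ^ 2 := by nlinarith
  have h8 : c * ‖w‖ ^ 2 ≤ c * (4 * r ^ 2) := by gcongr
  have h9 : c * r / 2 * (8 * r) ≤ ‖w - inner ℝ τ w • τ‖ * (8 * r) := by gcongr
  linarith

/-- A point at distance `r` from an arc of the curve, whose foot point on the arc is not in the
direction of the tangent, contributes `r ^ (1 - p)` to the energy. -/
theorem ofReal_rpow_le_lintegral_tangentPointDensity {p c L a b s₀ t : ℝ} {G v : ℝ → E}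
    (hp : 0 < p) (hG : ∀ s, HasDerivAt G (v s) s) (hu : ∀ s, ‖v s‖ = 1) (hc : 0 < c) (hc1 : c ≤ 1)
    (hW : Icc a b ⊆ Icc 0 L) (hs₀ : s₀ ∈ Icc a b) (hpos : 0 < ‖G t - G s₀‖)
    (hle : ‖G t - G s₀‖ ≤ b - a)
    (hin : |inner ℝ (v s₀) (G t - G s₀)| ≤ (1 - c) * ‖G t - G s₀‖)
    (hosc : ∀ s ∈ Icc a b, ‖v s - v s₀‖ ≤ c / 4) :
    ENNReal.ofReal ((c / 4) ^ p * (c / 8) * ‖G t - G s₀‖ ^ (1 - p)) ≤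
      ∫⁻ s in Icc 0 L, tangentPointDensity p G v t s := by
  set r := ‖G t - G s₀‖ with hr
  -- The foot point may be an end of the arc, so a one-sided interval is taken on the longer side,
  -- where there is room for `r / 2`.
  obtain ⟨a', b', hab', hlen, hnear⟩ : ∃ a' b', Icc a' b' ⊆ Icc a b ∧ b' - a' = c * r / 8 ∧
      ∀ s ∈ Icc a' b', |s - s₀| ≤ c * r / 8 := by
    have hcr : c * r ≤ r := by nlinarith
    have hcr0 : 0 < c * r := by positivity
    rcases le_total (s₀ - a) (b - s₀) with h | h
    · refine ⟨s₀, s₀ + c * r / 8, Icc_subset_Icc hs₀.1 (by linarith), by ring, fun s hs => ?_⟩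
      rw [abs_le]; constructor <;> linarith [hs.1, hs.2]
    · refine ⟨s₀ - c * r / 8, s₀, Icc_subset_Icc (by linarith) hs₀.2, by ring, fun s hs => ?_⟩
      rw [abs_le]; constructor <;> linarith [hs.1, hs.2]
  calc ENNReal.ofReal ((c / 4) ^ p * (c / 8) * r ^ (1 - p))
      = ENNReal.ofReal (c / (4 * r)) ^ p * volume (Icc a' b') := by
        rw [Real.volume_Icc, hlen, ENNReal.ofReal_rpow_of_nonneg (by positivity) hp.le,
          ← ENNReal.ofReal_mul (by positivity)]
        congr 1
        rw [← div_div, Real.div_rpow (by positivity) hpos.le, Real.rpow_sub hpos, Real.rpow_one]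
        field_simp
    _ = ∫⁻ _ in Icc a' b', ENNReal.ofReal (c / (4 * r)) ^ p := by rw [setLIntegral_const]
    _ ≤ ∫⁻ s in Icc a' b', tangentPointDensity p G v t s := by
        refine setLIntegral_mono' measurableSet_Icc fun s hs => ?_
        refine ENNReal.rpow_le_rpow (ENNReal.ofReal_le_ofReal ?_) hp.le
        exact le_tangentPointCurvature (hu s) hc hpos hr.symm hin (hosc s (hab' hs))
          ((norm_sub_le_of_unit_speed hG hu s₀ s).trans (hnear s hs)) hc1
    _ ≤ _ := lintegral_mono_set (hab'.trans hW)

theorem lintegral_eq_top_of_rpow_le {p c u₀ t₁ : ℝ} (hp : 2 ≤ p) (hc : 0 < c) (hne : u₀ ≠ t₁)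
    {F : ℝ → ℝ≥0∞}
    (h : ∀ t ∈ uIcc u₀ t₁, t ≠ u₀ → ENNReal.ofReal (c * |t - u₀| ^ (1 - p)) ≤ F t) :
    ∫⁻ t in uIcc u₀ t₁, F t = ⊤ := by
  by_contra hfin
  set l := |t₁ - u₀| with hl
  have hl0 : 0 < l := abs_pos.2 (sub_ne_zero.2 hne.symm)
  -- Since `|t - u₀| ≤ l` and `2 - p ≤ 0`, the power dominates a multiple of the non-integrable `|t
  -- - u₀|⁻¹`. At `t = u₀` the inverse is `0` by convention.
  have hb : ∀ t ∈ uIoc u₀ t₁, ‖c * l ^ (2 - p) * (t - u₀)⁻¹‖ₑ ≤ F t := by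
    intro t ht
    rcases eq_or_ne t u₀ with rfl | htne
    · simp
    have ht' := uIoc_subset_uIcc ht
    refine le_trans ?_ (h t ht' htne)
    have h0 : 0 < |t - u₀| := abs_pos.2 (sub_ne_zero.2 htne)
    have h1 : |t - u₀| ≤ l := abs_sub_left_of_mem_uIcc ht'
    rw [← ofReal_norm, norm_mul, norm_inv, Real.norm_eq_abs (t - u₀),
      Real.norm_of_nonneg (by positivity), mul_assoc]
    refine ENNReal.ofReal_le_ofReal ?_
    gcongr
    have e : |t - u₀| ^ (1 - p) = |t - u₀| ^ (2 - p) * |t - u₀|⁻¹ := by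
      rw [← Real.rpow_neg_one, ← Real.rpow_add h0]; congr 1; ring
    rw [e]
    gcongr ?_ * _
    exact Real.rpow_le_rpow_of_nonpos h0 h1 (by linarith)
  have hint : IntervalIntegrable (fun t => c * l ^ (2 - p) * (t - u₀)⁻¹) volume u₀ t₁ := by
    rw [intervalIntegrable_iff]
    refine ⟨(by fun_prop : Measurable fun t => c * l ^ (2 - p) * (t - u₀)⁻¹).aestronglyMeasurable,
      ?_⟩
    refine lt_of_le_of_lt ?_ (lt_top_iff_ne_top.2 hfin)
    exact (setLIntegral_mono' measurableSet_uIoc hb).trans (lintegral_mono_set uIoc_subset_uIcc)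
  have h2 : IntervalIntegrable (fun t => (t - u₀)⁻¹) volume u₀ t₁ := by
    have := hint.const_mul (c * l ^ (2 - p))⁻¹
    refine this.congr fun t _ => ?_
    have : 0 < c * l ^ (2 - p) := by positivity
    field_simp
  rcases intervalIntegrable_sub_inv_iff.1 h2 with h3 | h3
  · exact hne h3
  · exact h3 left_mem_uIcc

/-- If a curve of finite energy meets the arc `G '' [a, b]`, it does not leave it, as long as the
foot points on the arc are not in the direction of the tangent. -/
theorem mem_image_of_foot_points {p c L a b t₀ t₁ : ℝ} {G v : ℝ → E} (hp : 2 ≤ p)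
    (hG : ∀ s, HasDerivAt G (v s) s) (hu : ∀ s, ‖v s‖ = 1) (hc : 0 < c) (hc1 : c ≤ 1)
    (hfin : ∫⁻ t in Icc 0 L, ∫⁻ s in Icc 0 L, tangentPointDensity p G v t s ≠ ⊤)
    (hW : Icc a b ⊆ Icc 0 L) (hosc : ∀ s ∈ Icc a b, ∀ s' ∈ Icc a b, ‖v s - v s'‖ ≤ c / 4)
    (hT : uIcc t₀ t₁ ⊆ Icc 0 L) (hlen : |t₁ - t₀| ≤ b - a) (ht₀ : G t₀ ∈ G '' Icc a b)
    (hfoot : ∀ t ∈ uIcc t₀ t₁, ∀ s₀ ∈ Icc a b, IsMinOn (fun s => ‖G t - G s‖) (Icc a b) s₀ →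
      |inner ℝ (v s₀) (G t - G s₀)| ≤ (1 - c) * ‖G t - G s₀‖) :
    G t₁ ∈ G '' Icc a b := by
  have hGc : Continuous G := continuous_iff_continuousAt.2 fun s => (hG s).continuousAt
  have hWc : IsCompact (G '' Icc a b) := isCompact_Icc.image hGc
  have hWne : (Icc a b).Nonempty := by
    obtain ⟨s, hs, _⟩ := ht₀
    exact ⟨s, hs⟩
  have hZ : IsCompact (uIcc t₀ t₁ ∩ G ⁻¹' (G '' Icc a b)) :=
    isCompact_uIcc.inter_right (hWc.isClosed.preimage hGc)
  -- The last contact with the arc on the way from `t₀` to `t₁`.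
  obtain ⟨u₀, hu₀, hmin⟩ := hZ.exists_isMinOn ⟨t₀, left_mem_uIcc, ht₀⟩
    (f := fun t => |t - t₁|) (by fun_prop)
  by_contra hcon
  have hne : u₀ ≠ t₁ := by
    rintro rfl
    exact hcon hu₀.2
  have hsub : uIcc u₀ t₁ ⊆ uIcc t₀ t₁ := uIcc_subset_uIcc_right hu₀.1
  have hkey : ∀ t ∈ uIcc u₀ t₁, t ≠ u₀ →
      ENNReal.ofReal ((c / 4) ^ p * (c / 8) * |t - u₀| ^ (1 - p)) ≤
        ∫⁻ s in Icc 0 L, tangentPointDensity p G v t s := by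
    intro t ht htne
    have hnot : G t ∉ G '' Icc a b := by
      intro hmem
      have h1 : |u₀ - t₁| ≤ |t - t₁| := hmin ⟨hsub ht, hmem⟩
      rcases le_total u₀ t₁ with h | h
      · rw [uIcc_of_le h] at ht
        rw [abs_of_nonpos (by linarith), abs_of_nonpos (by linarith [ht.2])] at h1
        exact htne (le_antisymm (by linarith) ht.1)
      · rw [uIcc_of_ge h] at ht
        rw [abs_of_nonneg (by linarith), abs_of_nonneg (by linarith [ht.1])] at h1
        exact htne (le_antisymm ht.2 (by linarith))
    obtain ⟨s₀, hs₀, hs₀min⟩ := isCompact_Icc.exists_isMinOn hWne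
      (f := fun s => ‖G t - G s‖) (by fun_prop)
    have hpos : 0 < ‖G t - G s₀‖ := by
      rw [norm_pos_iff, sub_ne_zero]
      intro h
      exact hnot ⟨s₀, hs₀, h.symm⟩
    have hle : ‖G t - G s₀‖ ≤ |t - u₀| := by
      obtain ⟨s', hs', hs'eq⟩ := hu₀.2
      have h1 : ‖G t - G s₀‖ ≤ ‖G t - G s'‖ := hs₀min hs'
      rw [hs'eq] at h1
      exact h1.trans (norm_sub_le_of_unit_speed hG hu u₀ t)
    have hle2 : |t - u₀| ≤ b - a := by
      refine le_trans ?_ hlen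
      exact abs_sub_le_of_uIcc_subset_uIcc (uIcc_subset_uIcc hu₀.1 (hsub ht))
    refine le_trans (ENNReal.ofReal_le_ofReal ?_)
      (ofReal_rpow_le_lintegral_tangentPointDensity (by linarith) hG hu hc hc1 hW hs₀ hpos
        (hle.trans hle2) (hfoot t (hsub ht) s₀ hs₀ hs₀min) fun s hs => hosc s hs s₀ hs₀)
    have := Real.rpow_le_rpow_of_nonpos hpos hle (by linarith : 1 - p ≤ 0)
    gcongr
  have htop := lintegral_eq_top_of_rpow_le hp (by positivity) hne hkey
  refine hfin (top_le_iff.1 ?_)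
  rw [← htop]
  exact lintegral_mono_set (hsub.trans hT)

/-- Only right difference quotients of the squared distance are used, so the left end of the arc is
admitted. Reversing the parameter gives the opposite sign away from the left end. -/
theorem inner_le_zero_of_isMinOn {a b s₀ : ℝ} {y : E} {G : ℝ → E} {w : E}
    (hG : HasDerivAt G w s₀) (hs₀ : s₀ ∈ Ico a b)
    (hmin : IsMinOn (fun s => ‖y - G s‖) (Icc a b) s₀) : inner ℝ w (y - G s₀) ≤ 0 := by
  have hd : HasDerivAt (fun s => ‖y - G s‖ ^ 2) (2 * inner ℝ (y - G s₀) (-w)) s₀ := by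
    simpa using (hG.const_sub y).norm_sq
  have hsl := (hasDerivWithinAt_iff_tendsto_slope' (self_notMem_Ioi)).1
    (hd.hasDerivWithinAt (s := Ioi s₀))
  have h0 : 0 ≤ 2 * inner ℝ (y - G s₀) (-w) := by
    refine ge_of_tendsto hsl ?_
    filter_upwards [Ioo_mem_nhdsGT hs₀.2] with s hs
    rw [slope_def_field]
    refine div_nonneg ?_ (by linarith [hs.1])
    have h1 : ‖y - G s₀‖ ≤ ‖y - G s‖ := hmin ⟨hs₀.1.trans hs.1.le, hs.2.le⟩
    have := pow_le_pow_left₀ (norm_nonneg _) h1 2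
    linarith
  rw [inner_neg_right, real_inner_comm] at h0
  linarith

theorem inner_nonneg_of_isMinOn {a b s₀ : ℝ} {y : E} {G : ℝ → E} {w : E}
    (hG : HasDerivAt G w s₀) (hs₀ : s₀ ∈ Ioc a b)
    (hmin : IsMinOn (fun s => ‖y - G s‖) (Icc a b) s₀) : 0 ≤ inner ℝ w (y - G s₀) := by
  have hG' : HasDerivAt (fun s => G (-s)) (-w) (-s₀) := by
    have : HasDerivAt G w (-(-s₀)) := by rwa [neg_neg]
    simpa [Function.comp_def] using this.scomp (-s₀) (hasDerivAt_neg (-s₀))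
  have := inner_le_zero_of_isMinOn (a := -b) (b := -a) (y := y) hG'
    ⟨by linarith [hs₀.2], by linarith [hs₀.1]⟩ (fun s hs => by
      have h1 : ‖y - G s₀‖ ≤ ‖y - G (-s)‖ := hmin ⟨by linarith [hs.2], by linarith [hs.1]⟩
      simpa using h1)
  rw [neg_neg, inner_neg_left] at this
  linarith

end SelfContact


/-! ### Straightening charts of the ambient space. -/

section Charts

theorem exists_ball_of_preimage_subset {X : Type*} [MetricSpace X] {G : ℝ → X}
    (hG : Continuous G) {L : ℝ} {x : X} {U : Set ℝ} (hU : IsOpen U)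
    (h : ∀ t ∈ Icc 0 L, G t = x → t ∈ U) :
    ∃ r > 0, ∀ t ∈ Icc 0 L, G t ∈ Metric.ball x r → t ∈ U := by
  have hc : IsCompact (G '' (Icc 0 L \ U)) := (isCompact_Icc.diff hU).image hG
  have hx : x ∈ (G '' (Icc 0 L \ U))ᶜ := by
    rintro ⟨t, ht, rfl⟩
    exact ht.2 (h t ht.1 rfl)
  obtain ⟨r, hr, hball⟩ := Metric.isOpen_iff.1 hc.isClosed.isOpen_compl x hx
  refine ⟨r, hr, fun t ht htr => ?_⟩
  by_contra hcon
  exact hball htr ⟨t, ⟨ht, hcon⟩, rfl⟩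

variable {E : Type} [NormedAddCommGroup E] [InnerProductSpace ℝ E]

/-- There is a `C¹` chart of the ambient space around `x` that maps `S` onto a piece of
`{c • e | c ∈ A}`. -/
def HasChartAt (S : Set E) (x : E) (A : Set ℝ) : Prop :=
  ∃ (Φ : OpenPartialHomeomorph E E) (e : E),
    x ∈ Φ.source ∧ ContDiffOn ℝ 1 Φ Φ.source ∧ ContDiffOn ℝ 1 Φ.symm Φ.target ∧ e ≠ 0 ∧
      Φ '' (Φ.source ∩ S) = Φ.target ∩ {y | ∃ c ∈ A, y = c • e}

/-- A `C¹` arc is straightened by a chart of the ambient space. -/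
theorem exists_hasChartAt [CompleteSpace E] {β : ℝ → E} (hβ : ContDiff ℝ 1 β)
    (hβ' : ‖deriv β 0‖ = 1) :
    ∃ ε₀ > 0, ∀ ε > 0, ε ≤ ε₀ → ∀ r > 0, ∀ (S : Set E) (A : Set ℝ),
      S ∩ Metric.ball (β 0) r ⊆ β '' (Ioo (-ε) ε ∩ A) → β '' (Ioo (-ε) ε ∩ A) ⊆ S →
        HasChartAt S (β 0) A := by
  set τ := deriv β 0 with hτ
  -- Bends the line `ℝ τ` onto the arc and translates the normal directions along; its derivative at
  -- `0` is the identity. The chart is a local inverse of `F`.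
  set F : E → E := fun z => β (inner ℝ τ z) + (z - inner ℝ τ z • τ) with hF
  have hττ : inner ℝ τ τ = 1 := by rw [real_inner_self_eq_norm_sq, hβ']; norm_num
  have hFline : ∀ k : ℝ, F (k • τ) = β k := by
    intro k
    simp only [hF, inner_smul_right, hττ, mul_one, sub_self, add_zero]
  have hF0 : F 0 = β 0 := by simpa using hFline 0
  have hFc : ContDiff ℝ 1 F := by
    have h1 : ContDiff ℝ 1 fun z : E => inner ℝ τ z := contDiff_const.inner ℝ contDiff_id
    exact (hβ.comp h1).add (contDiff_id.sub (h1.smul contDiff_const))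
  have hFd : HasFDerivAt F ((ContinuousLinearEquiv.refl ℝ E : E ≃L[ℝ] E) : E →L[ℝ] E) 0 := by
    have h1 : HasFDerivAt (fun z : E => inner ℝ τ z) (innerSL ℝ τ) 0 :=
      (innerSL ℝ τ).hasFDerivAt
    have h2 : HasDerivAt β τ (inner ℝ τ (0 : E)) := by
      rw [inner_zero_right]
      exact (hβ.differentiable one_ne_zero 0).hasDerivAt
    have h3 : HasFDerivAt (fun z : E => β (inner ℝ τ z)) ((innerSL ℝ τ).smulRight τ) 0 := by
      refine (h2.hasFDerivAt.comp (0 : E) h1).congr_fderiv ?_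
      ext z
      simp
    have h4 : HasFDerivAt (fun z : E => z - inner ℝ τ z • τ)
        (ContinuousLinearMap.id ℝ E - (innerSL ℝ τ).smulRight τ) 0 :=
      (hasFDerivAt_id (0 : E)).sub (h1.smul_const τ)
    refine (h3.add h4).congr_fderiv ?_
    ext z
    simp
  set e₀ := hFc.contDiffAt.toOpenPartialHomeomorph F hFd one_ne_zero with he₀
  have hcoe : ∀ z, e₀ z = F z := fun z => rfl
  have h0src : (0 : E) ∈ e₀.source :=
    hFc.contDiffAt.mem_toOpenPartialHomeomorph_source hFd one_ne_zero
  have hinv : ContDiffAt ℝ 1 e₀.symm (F 0) := hFc.contDiffAt.to_localInverse hFd one_ne_zero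
  obtain ⟨N, hNsub, hNo, hN0⟩ := mem_nhds_iff.1 (hinv.eventually (by simp))
  obtain ⟨ε₀, hε₀, hball⟩ := Metric.isOpen_iff.1 e₀.open_source 0 h0src
  refine ⟨ε₀, hε₀, ?_⟩
  intro ε hε hεε₀ r hr S A hS1 hS2
  -- The first condition keeps the inverse `C¹` and the image in the ball where `S` is known; the
  -- second restricts points of the line to parameters covered by the arc.
  set U : Set E := F ⁻¹' (N ∩ Metric.ball (β 0) r) ∩ {z | |inner ℝ τ z| < ε} with hU
  have hUo : IsOpen U := ((hNo.inter Metric.isOpen_ball).preimage hFc.continuous).inter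
    (isOpen_lt (by fun_prop : Continuous fun z : E => |inner ℝ τ z|) continuous_const)
  set e₁ := e₀.restrOpen U hUo with he₁
  have hsrc : e₁.source = e₀.source ∩ U := e₀.restrOpen_source U hUo
  have hcoe1 : ∀ z, e₁ z = F z := fun z => rfl
  have hlt : ∀ y ∈ e₁.target, F (e₁.symm y) = y := fun y hy => e₁.right_inv hy
  have hN : ∀ y ∈ e₁.target, y ∈ N ∩ Metric.ball (β 0) r := by
    intro y hy
    have := e₁.map_target hy
    rw [hsrc] at this
    have h2 := this.2.1
    rwa [mem_preimage, hlt y hy] at h2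
  have h0U : (0 : E) ∈ e₁.source := by
    rw [hsrc]
    refine ⟨h0src, ⟨hN0, ?_⟩, ?_⟩
    · rw [hF0]; exact Metric.mem_ball_self hr
    · simpa using hε
  refine ⟨e₁.symm, τ, ?_, ?_, ?_, ?_, ?_⟩
  · have := e₁.map_source h0U
    rwa [hcoe1, hF0] at this
  · intro y hy
    exact ContDiffAt.contDiffWithinAt (hNsub (hN y hy).1)
  · exact hFc.contDiffOn
  · rw [← norm_ne_zero_iff, hβ']; exact one_ne_zero
  · ext z
    constructor
    · rintro ⟨y, ⟨hy, hyS⟩, rfl⟩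
      refine ⟨e₁.symm.map_source hy, ?_⟩
      obtain ⟨k, ⟨hk, hkA⟩, hky⟩ := hS1 ⟨hyS, (hN y hy).2⟩
      refine ⟨k, hkA, ?_⟩
      have habs : |k| < ε := abs_lt.2 hk
      have hmem : k • τ ∈ e₁.source := by
        rw [hsrc]
        refine ⟨hball ?_, ?_, ?_⟩
        · rw [mem_ball_zero_iff, norm_smul, hβ', mul_one]
          exact habs.trans_le hεε₀
        · rw [mem_preimage, hFline, hky]; exact hN y hy
        · change |inner ℝ τ (k • τ)| < ε
          rwa [inner_smul_right, hττ, mul_one]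
      have := e₁.left_inv hmem
      rwa [hcoe1, hFline, hky] at this
    · rintro ⟨hz, k, hkA, rfl⟩
      have hz' : k • τ ∈ e₁.source := hz
      have hmem := hz'
      rw [hsrc] at hmem
      have habs : |inner ℝ τ (k • τ)| < ε := hmem.2.2
      rw [inner_smul_right, hττ, mul_one] at habs
      refine ⟨e₁ (k • τ), ⟨e₁.map_source hz', ?_⟩, e₁.left_inv hz'⟩
      rw [hcoe1, hFline]
      exact hS2 ⟨k, ⟨abs_lt.1 habs, hkA⟩, rfl⟩

theorem contDiff_one_of_hasDerivAt {G v : ℝ → E} (hv : Continuous v)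
    (hG : ∀ s, HasDerivAt G (v s) s) : ContDiff ℝ 1 G := by
  rw [contDiff_one_iff_deriv]
  refine ⟨fun s => (hG s).differentiableAt, ?_⟩
  have : deriv G = v := funext fun s => (hG s).deriv
  rwa [this]

variable {G v : ℝ → E} {L : ℝ}

/-- The reparametrized curve `k ↦ G (s + σ k)` with `σ = ±1`. -/
theorem exists_hasChartAt_comp [CompleteSpace E] (hv : Continuous v)
    (hG : ∀ s, HasDerivAt G (v s) s) (hu : ∀ s, ‖v s‖ = 1) (s σ : ℝ) (hσ : |σ| = 1) :
    ∃ ε₀ > 0, ∀ ε > 0, ε ≤ ε₀ → ∀ r > 0, ∀ (S : Set E) (A : Set ℝ),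
      S ∩ Metric.ball (G s) r ⊆ (fun k => G (s + σ * k)) '' (Ioo (-ε) ε ∩ A) →
      (fun k => G (s + σ * k)) '' (Ioo (-ε) ε ∩ A) ⊆ S → HasChartAt S (G s) A := by
  have hd : ∀ k, HasDerivAt (fun k => G (s + σ * k)) (σ • v (s + σ * k)) k := by
    intro k
    have h1 : HasDerivAt (fun k : ℝ => s + σ * k) σ k := by
      simpa using ((hasDerivAt_id k).const_mul σ).const_add s
    exact (hG (s + σ * k)).scomp k h1
  have hc : ContDiff ℝ 1 fun k => G (s + σ * k) :=
    contDiff_one_of_hasDerivAt (by fun_prop) hd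
  have := exists_hasChartAt hc (by rw [(hd 0).deriv, norm_smul, hu, Real.norm_eq_abs, hσ, mul_one])
  simpa using this

theorem hasChartAt_left_endpoint [CompleteSpace E] (hL : 0 < L) (hv : Continuous v)
    (hG : ∀ s, HasDerivAt G (v s) s) (hu : ∀ s, ‖v s‖ = 1)
    (honly : ∀ t ∈ Icc 0 L, G t = G 0 → t = 0) : HasChartAt (G '' Icc 0 L) (G 0) (Ici 0) := by
  have hGc : Continuous G := continuous_iff_continuousAt.2 fun s => (hG s).continuousAt
  obtain ⟨ε₀, hε₀, hchart⟩ := exists_hasChartAt_comp hv hG hu 0 1 (by simp)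
  simp only [zero_add, one_mul] at hchart
  set ε := min ε₀ L
  have hε : 0 < ε := lt_min hε₀ hL
  obtain ⟨r, hr, hball⟩ := exists_ball_of_preimage_subset hGc (isOpen_Iio (a := ε)) (L := L)
    (x := G 0) (fun t ht h => by rw [honly t ht h]; exact hε)
  refine hchart ε hε (min_le_left _ _) r hr _ _ ?_ ?_
  · rintro _ ⟨⟨t, ht, rfl⟩, htr⟩
    exact ⟨t, ⟨⟨by linarith [ht.1], hball t ht htr⟩, ht.1⟩, rfl⟩
  · rintro _ ⟨k, ⟨hk, hk0⟩, rfl⟩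
    exact ⟨k, ⟨hk0, hk.2.le.trans (min_le_right _ _)⟩, rfl⟩

theorem hasChartAt_right_endpoint [CompleteSpace E] (hL : 0 < L) (hv : Continuous v)
    (hG : ∀ s, HasDerivAt G (v s) s) (hu : ∀ s, ‖v s‖ = 1)
    (honly : ∀ t ∈ Icc 0 L, G t = G L → t = L) : HasChartAt (G '' Icc 0 L) (G L) (Ici 0) := by
  have hGc : Continuous G := continuous_iff_continuousAt.2 fun s => (hG s).continuousAt
  obtain ⟨ε₀, hε₀, hchart⟩ := exists_hasChartAt_comp hv hG hu L (-1) (by simp)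
  set ε := min ε₀ L
  have hε : 0 < ε := lt_min hε₀ hL
  obtain ⟨r, hr, hball⟩ := exists_ball_of_preimage_subset hGc (isOpen_Ioi (a := L - ε)) (L := L)
    (x := G L) (fun t ht h => by rw [honly t ht h]; exact sub_lt_self _ hε)
  refine hchart ε hε (min_le_left _ _) r hr _ _ ?_ ?_
  · rintro _ ⟨⟨t, ht, rfl⟩, htr⟩
    have h1 : L - ε < t := hball t ht htr
    refine ⟨L - t, ⟨⟨by linarith [ht.2], by linarith⟩, sub_nonneg.2 ht.2⟩, ?_⟩
    simp
  · rintro _ ⟨k, ⟨hk, hk0⟩, rfl⟩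
    have h1 : ε ≤ L := min_le_right _ _
    have h2 : 0 ≤ k := hk0
    exact ⟨L + -1 * k, ⟨by linarith [hk.2], by linarith⟩, rfl⟩

/-- A closed curve whose tangents at the two end points agree. -/
theorem hasChartAt_closing_point [CompleteSpace E] (hL : 0 < L) (hv : Continuous v)
    (hG : ∀ s, HasDerivAt G (v s) s) (hu : ∀ s, ‖v s‖ = 1) (hclosed : G L = G 0)
    (htangent : v L = v 0) (honly : ∀ t ∈ Icc 0 L, G t = G 0 → t = 0 ∨ t = L) :
    HasChartAt (G '' Icc 0 L) (G 0) univ := by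
  have hGc : Continuous G := continuous_iff_continuousAt.2 fun s => (hG s).continuousAt
  -- On each half-line one of the first two terms is the constant `v L = v 0` and cancels, so `V`
  -- continues the final tangents by the initial ones.
  set V : ℝ → E := fun k => v (max k 0) + v (L + min k 0) - v 0 with hV
  have hVc : Continuous V := by fun_prop
  set β : ℝ → E := fun k => G 0 + ∫ u in (0 : ℝ)..k, V u with hβ
  have hβd : ∀ k, HasDerivAt β (V k) k := fun k =>
    (intervalIntegral.integral_hasDerivAt_right (hVc.intervalIntegrable _ _)
      (hVc.stronglyMeasurableAtFilter _ _) hVc.continuousAt).const_add _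
  have hβpos : ∀ k, 0 ≤ k → β k = G k := by
    intro k hk
    have : ∫ u in (0 : ℝ)..k, V u = ∫ u in (0 : ℝ)..k, v u := by
      refine intervalIntegral.integral_congr fun u hu' => ?_
      rw [uIcc_of_le hk] at hu'
      simp [hV, hu'.1, htangent]
    simp only [hβ]
    rw [this, intervalIntegral.integral_eq_sub_of_hasDerivAt (fun u _ => hG u)
      (hv.intervalIntegrable _ _)]
    abel
  have hβneg : ∀ k, k ≤ 0 → β k = G (L + k) := by
    intro k hk
    have : ∫ u in (0 : ℝ)..k, V u = ∫ u in (0 : ℝ)..k, v (L + u) := by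
      refine intervalIntegral.integral_congr fun u hu' => ?_
      rw [uIcc_of_ge hk] at hu'
      simp [hV, hu'.2]
    simp only [hβ]
    rw [this, intervalIntegral.integral_comp_add_left, add_zero,
      intervalIntegral.integral_eq_sub_of_hasDerivAt (fun u _ => hG u)
      (hv.intervalIntegrable _ _), hclosed]
    abel
  have hβ0 : β 0 = G 0 := hβpos 0 le_rfl
  obtain ⟨ε₀, hε₀, hchart⟩ := exists_hasChartAt (contDiff_one_of_hasDerivAt hVc hβd) (by
    rw [(hβd 0).deriv]; simp [hV, htangent, hu])
  set ε := min ε₀ L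
  have hε : 0 < ε := lt_min hε₀ hL
  have hεL : ε ≤ L := min_le_right _ _
  obtain ⟨r, hr, hball⟩ := exists_ball_of_preimage_subset hGc
    ((isOpen_Iio (a := ε)).union (isOpen_Ioi (a := L - ε))) (L := L) (x := G 0) (fun t ht h => by
      rcases honly t ht h with rfl | rfl
      · exact Or.inl hε
      · exact Or.inr (sub_lt_self _ hε))
  have := hchart ε hε (min_le_left _ _) r hr (G '' Icc 0 L) univ
  rw [hβ0] at this
  refine this ?_ ?_
  · rintro _ ⟨⟨t, ht, rfl⟩, htr⟩
    rcases hball t ht htr with h1 | h1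
    · exact ⟨t, ⟨⟨by linarith [ht.1], h1⟩, trivial⟩, hβpos t ht.1⟩
    · have h1 : L - ε < t := h1
      refine ⟨t - L, ⟨⟨by linarith, by linarith [ht.2]⟩, trivial⟩, ?_⟩
      rw [hβneg _ (by linarith [ht.2])]
      simp
  · rintro _ ⟨k, ⟨hk, -⟩, rfl⟩
    rcases le_total 0 k with h | h
    · exact ⟨k, ⟨h, hk.2.le.trans hεL⟩, (hβpos k h).symm⟩
    · exact ⟨L + k, ⟨by linarith [hk.1], by linarith⟩, (hβneg k h).symm⟩

end Charts


/-! ### Local structure of the image of a curve of finite energy. -/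

section Embedded

variable {E : Type} [NormedAddCommGroup E] {G v : ℝ → E} {L p : ℝ}

theorem exists_forall_norm_sub_le (hv : Continuous v) (s : ℝ) {c : ℝ} (hc : 0 < c) :
    ∃ δ > 0, ∀ u u', |u - s| ≤ δ → |u' - s| ≤ δ → ‖v u - v u'‖ ≤ c := by
  obtain ⟨δ, hδ, h⟩ := Metric.continuousAt_iff.1 (hv.continuousAt (x := s)) (c / 2) (half_pos hc)
  refine ⟨δ / 2, half_pos hδ, fun u u' hu hu' => ?_⟩
  have h1 := h (show dist u s < δ by rw [Real.dist_eq]; linarith)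
  have h2 := h (show dist u' s < δ by rw [Real.dist_eq]; linarith)
  have := dist_triangle_right (v u) (v u') (v s)
  rw [dist_eq_norm] at this
  linarith

/-- The foot points of points near `x` stay near `x`. -/
theorem norm_foot_point_sub_lt {W : Set ℝ} {x y : E} {ρ s₀ s₁ : ℝ} (hs₁ : s₁ ∈ W) (hx : G s₁ = x)
    (hmin : IsMinOn (fun s => ‖y - G s‖) W s₀) (hy : ‖y - x‖ < ρ) : ‖G s₀ - x‖ < 2 * ρ := by
  have h1 : ‖y - G s₀‖ ≤ ‖y - G s₁‖ := hmin hs₁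
  rw [hx] at h1
  have h2 := norm_sub_le_norm_sub_add_norm_sub (G s₀) y x
  rw [norm_sub_rev (G s₀) y] at h2
  linarith

variable [InnerProductSpace ℝ E]

theorem half_mul_le_norm_sub (hG : ∀ s, HasDerivAt G (v s) s) (hu : ∀ s, ‖v s‖ = 1) {s t : ℝ}
    (hst : s ≤ t) {w : ℝ} (hw : ∀ u ∈ Icc s t, ‖v w - v u‖ ≤ 1) :
    (t - s) / 2 ≤ ‖G t - G s‖ := by
  have h1 := mul_le_inner_sub hG (τ := v w) (c := 1 / 2) hst fun u hu' =>
    half_le_inner_of_norm_sub_le (hu w) (hu u) (hw u hu')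
  have h2 := real_inner_le_norm (v w) (G t - G s)
  rw [hu, one_mul] at h2
  linarith

/-- Near `G s₁`, foot points on a short arc centred at `s₁` are interior to the arc, so the
connecting chord is normal to it and the self-contact argument applies with `c = 1`. Every passage
near the point then stays on this arc. -/
theorem hasChartAt_interior_point [CompleteSpace E] (hp : 2 ≤ p) (hv : Continuous v)
    (hG : ∀ s, HasDerivAt G (v s) s) (hu : ∀ s, ‖v s‖ = 1)
    (hfin : ∫⁻ t in Icc 0 L, ∫⁻ s in Icc 0 L, tangentPointDensity p G v t s ≠ ⊤)
    {s₁ : ℝ} (hs₁ : s₁ ∈ Ioo 0 L) : HasChartAt (G '' Icc 0 L) (G s₁) univ := by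
  have hGc : Continuous G := continuous_iff_continuousAt.2 fun s => (hG s).continuousAt
  obtain ⟨ε₀, hε₀, hchart⟩ := exists_hasChartAt_comp hv hG hu s₁ 1 (by simp)
  simp only [one_mul] at hchart
  obtain ⟨δ, hδ, hosc⟩ := exists_forall_norm_sub_le hv s₁ (c := 1 / 4) (by norm_num)
  obtain ⟨ε, hε, h1, h2, h3, h4⟩ : ∃ ε > 0, 2 * ε ≤ ε₀ ∧ ε ≤ δ ∧ 2 * ε ≤ s₁ ∧ 2 * ε ≤ L - s₁ := by
    have : 0 < min (min (ε₀ / 2) δ) (min (s₁ / 2) ((L - s₁) / 2)) := by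
      have := hs₁.1
      have := hs₁.2
      refine lt_min (lt_min ?_ ?_) (lt_min ?_ ?_) <;> linarith
    refine ⟨_, this, ?_, ?_, ?_, ?_⟩
    · linarith [(min_le_left (min (ε₀ / 2) δ) (min (s₁ / 2) ((L - s₁) / 2))).trans
        (min_le_left _ _)]
    · exact (min_le_left _ _).trans (min_le_right _ _)
    · linarith [(min_le_right (min (ε₀ / 2) δ) (min (s₁ / 2) ((L - s₁) / 2))).trans
        (min_le_left _ _)]
    · linarith [(min_le_right (min (ε₀ / 2) δ) (min (s₁ / 2) ((L - s₁) / 2))).trans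
        (min_le_right _ _)]
  have hnear : ∀ u ∈ Icc (s₁ - ε) (s₁ + ε), |u - s₁| ≤ δ := by
    intro u hu'
    rw [abs_le]; constructor <;> linarith [hu'.1, hu'.2]
  have hW : Icc (s₁ - ε) (s₁ + ε) ⊆ Icc 0 L := Icc_subset_Icc (by linarith) (by linarith)
  have hs₁W : s₁ ∈ Icc (s₁ - ε) (s₁ + ε) := ⟨by linarith, by linarith⟩
  have hright : ε / 2 ≤ ‖G (s₁ + ε) - G s₁‖ := by
    have := half_mul_le_norm_sub hG hu (s := s₁) (t := s₁ + ε) (by linarith) (w := s₁)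
      fun u hu' => (hosc s₁ u (hnear _ hs₁W) (hnear u ⟨by linarith [hu'.1], hu'.2⟩)).trans
        (by norm_num)
    simpa using this
  have hleft : ε / 2 ≤ ‖G (s₁ - ε) - G s₁‖ := by
    have := half_mul_le_norm_sub hG hu (s := s₁ - ε) (t := s₁) (by linarith) (w := s₁)
      fun u hu' => (hosc s₁ u (hnear _ hs₁W) (hnear u ⟨hu'.1, by linarith [hu'.2]⟩)).trans
        (by norm_num)
    rw [norm_sub_rev]
    simpa using this
  -- The radius `ε / 4` puts foot points within `ε / 2` of `G s₁`, closer than the ends of the arc.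
  obtain ⟨r, hr, hball⟩ := exists_ball_of_preimage_subset hGc
    (U := Metric.thickening (ε / 4) {t ∈ Icc 0 L | G t = G s₁}) Metric.isOpen_thickening (L := L)
    (x := G s₁) (fun t ht h => Metric.self_subset_thickening (by linarith) _ ⟨ht, h⟩)
  have hcontain : ∀ t ∈ Icc 0 L, G t ∈ Metric.ball (G s₁) r →
      G t ∈ G '' Icc (s₁ - ε) (s₁ + ε) := by
    intro t ht htr
    obtain ⟨t₀, ⟨ht₀, ht₀x⟩, hdist⟩ := Metric.mem_thickening_iff.1 (hball t ht htr)
    rw [Real.dist_eq] at hdist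
    refine mem_image_of_foot_points hp hG hu one_pos le_rfl hfin hW
      (fun s hs s' hs' => hosc s s' (hnear s hs) (hnear s' hs')) (uIcc_subset_Icc ht₀ ht)
      (by linarith) ⟨s₁, hs₁W, ht₀x.symm⟩ ?_
    intro t' ht' s₀ hs₀ hmin
    have hy : ‖G t' - G s₁‖ < ε / 4 := by
      rw [← ht₀x]
      exact ((norm_sub_le_of_unit_speed hG hu t₀ t').trans
        (abs_sub_left_of_mem_uIcc ht')).trans_lt hdist
    have hlt := norm_foot_point_sub_lt hs₁W rfl hmin hy
    have hne1 : s₀ ≠ s₁ + ε := by rintro rfl; linarith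
    have hne2 : s₀ ≠ s₁ - ε := by rintro rfl; linarith
    have h5 := inner_le_zero_of_isMinOn (hG s₀) ⟨hs₀.1, lt_of_le_of_ne hs₀.2 hne1⟩ hmin
    have h6 := inner_nonneg_of_isMinOn (hG s₀) ⟨lt_of_le_of_ne hs₀.1 hne2.symm, hs₀.2⟩ hmin
    rw [le_antisymm h5 h6]
    simp
  refine hchart (2 * ε) (by linarith) h1 r hr _ _ ?_ ?_
  · rintro _ ⟨⟨t, ht, rfl⟩, htr⟩
    obtain ⟨s, hs, hst⟩ := hcontain t ht htr
    refine ⟨s - s₁, ⟨⟨by linarith [hs.1], by linarith [hs.2]⟩, trivial⟩, ?_⟩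
    simpa using hst
  · rintro _ ⟨k, ⟨hk, -⟩, rfl⟩
    exact ⟨s₁ + k, ⟨by linarith [hk.1], by linarith [hk.2]⟩, rfl⟩

/-- If the two end points agree, but the tangents there do not, then the end of the curve retraces
its beginning. -/
theorem hasChartAt_common_endpoint [CompleteSpace E] (hp : 2 ≤ p) (hL : 0 < L) (hv : Continuous v)
    (hG : ∀ s, HasDerivAt G (v s) s) (hu : ∀ s, ‖v s‖ = 1)
    (hfin : ∫⁻ t in Icc 0 L, ∫⁻ s in Icc 0 L, tangentPointDensity p G v t s ≠ ⊤)
    (hclosed : G L = G 0) (htangent : v L ≠ v 0)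
    (honly : ∀ t ∈ Icc 0 L, G t = G 0 → t = 0 ∨ t = L) :
    HasChartAt (G '' Icc 0 L) (G 0) (Ici 0) := by
  have hGc : Continuous G := continuous_iff_continuousAt.2 fun s => (hG s).continuousAt
  obtain ⟨ε₀, hε₀, hchart⟩ := exists_hasChartAt_comp hv hG hu 0 1 (by simp)
  simp only [zero_add, one_mul] at hchart
  -- Thus `⟨v 0, v L⟩ = 1 - 4a`. Near `L`, where tangents differ from `v L` by at most `a`, the
  -- chord to `G L` has component at most `(1 - 3a)(L - t)` along `v 0` and length at least `(1 -
  -- a)(L - t)`. As `1 - 3a ≤ (1 - a)²`, this gives the foot-point condition at the end of the arc.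
  set a := (1 - inner ℝ (v 0) (v L)) / 4 with ha
  have ha0 : 0 < a := by
    have := (inner_lt_one_iff_real_of_norm_eq_one (hu 0) (hu L)).2 htangent.symm
    linarith
  have ha1 : a ≤ 1 := by
    have := neg_le_of_abs_le (abs_real_inner_le_norm (v 0) (v L))
    rw [hu, hu] at this
    linarith
  obtain ⟨δ, hδ, hosc⟩ := exists_forall_norm_sub_le hv 0 (c := a / 4) (by positivity)
  obtain ⟨δ', hδ', hosc'⟩ := exists_forall_norm_sub_le hv L ha0
  obtain ⟨ε, hε, h1, h2, h3⟩ : ∃ ε > 0, 2 * ε ≤ ε₀ ∧ ε ≤ δ ∧ 2 * ε ≤ L := by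
    have : 0 < min (min (ε₀ / 2) δ) (L / 2) :=
      lt_min (lt_min (by linarith) hδ) (by linarith)
    refine ⟨_, this, ?_, ?_, ?_⟩
    · linarith [(min_le_left (min (ε₀ / 2) δ) (L / 2)).trans (min_le_left _ _)]
    · exact (min_le_left _ _).trans (min_le_right _ _)
    · linarith [min_le_right (min (ε₀ / 2) δ) (L / 2)]
  set ρ := min (ε / 4) δ' with hρ
  have hρ0 : 0 < ρ := lt_min (by linarith) hδ'
  have hρε : ρ ≤ ε / 4 := min_le_left _ _
  have hρδ : ρ ≤ δ' := min_le_right _ _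
  have hnear : ∀ u ∈ Icc 0 ε, |u - 0| ≤ δ := by
    intro u hu'
    rw [abs_le]; constructor <;> linarith [hu'.1, hu'.2]
  have hW : Icc 0 ε ⊆ Icc 0 L := Icc_subset_Icc le_rfl (by linarith)
  have h0W : (0 : ℝ) ∈ Icc 0 ε := ⟨le_rfl, hε.le⟩
  have hright : ε / 2 ≤ ‖G ε - G 0‖ := by
    have := half_mul_le_norm_sub hG hu (s := 0) (t := ε) hε.le (w := 0)
      fun u hu' => (hosc 0 u (hnear _ h0W) (hnear u hu')).trans (by linarith)
    simpa using this
  obtain ⟨r, hr, hball⟩ := exists_ball_of_preimage_subset hGc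
    ((isOpen_Iio (a := ε)).union (isOpen_Ioi (a := L - ρ))) (L := L) (x := G 0) (fun t ht h => by
      rcases honly t ht h with rfl | rfl
      · exact Or.inl hε
      · exact Or.inr (sub_lt_self _ hρ0))
  have hchord : ∀ t ∈ Ioc (L - ρ) L, -inner ℝ (v 0) (G t - G 0) ≤ (1 - a) * ‖G t - G 0‖ := by
    intro t ht
    have hn : ∀ u ∈ Icc t L, ‖v L - v u‖ ≤ a := by
      intro u hu'
      refine hosc' L u (by simpa using hδ'.le) ?_
      rw [abs_le]; constructor <;> linarith [ht.1, hu'.1, hu'.2]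
    have hA := mul_le_inner_sub hG (τ := v L) (c := 1 - a) ht.2 fun u hu' => by
      have e : inner ℝ (v L) (v u) = 1 - inner ℝ (v L) (v L - v u) := by
        rw [inner_sub_right, real_inner_self_eq_norm_sq, hu]; ring
      have := real_inner_le_norm (v L) (v L - v u)
      rw [hu, one_mul] at this
      linarith [hn u hu']
    have hB := mul_le_inner_sub hG (τ := -v 0) (c := -(1 - 3 * a)) ht.2 fun u hu' => by
      have e : inner ℝ (-v 0) (v u) = inner ℝ (v 0) (v L - v u) - inner ℝ (v 0) (v L) := by
        rw [inner_sub_right, inner_neg_left]; ring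
      have := neg_le_of_abs_le (abs_real_inner_le_norm (v 0) (v L - v u))
      rw [hu, one_mul] at this
      linarith [hn u hu']
    have hC := real_inner_le_norm (v L) (G L - G t)
    rw [hu, one_mul] at hC
    rw [inner_neg_left] at hB
    have e1 : -inner ℝ (v 0) (G t - G 0) = inner ℝ (v 0) (G L - G t) := by
      rw [← inner_neg_right, neg_sub, hclosed]
    have e2 : ‖G t - G 0‖ = ‖G L - G t‖ := by rw [norm_sub_rev, hclosed]
    rw [e1, e2]
    have hLt : 0 ≤ L - t := by linarith [ht.2]
    have h5 : (1 - a) * ((1 - a) * (L - t)) ≤ (1 - a) * ‖G L - G t‖ :=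
      mul_le_mul_of_nonneg_left (hA.trans hC) (by linarith)
    nlinarith [mul_nonneg ha0.le hLt, mul_nonneg (mul_nonneg ha0.le ha0.le) hLt]
  have hcontain : ∀ t ∈ Icc 0 L, G t ∈ Metric.ball (G 0) r → G t ∈ G '' Icc 0 ε := by
    intro t ht htr
    rcases hball t ht htr with h | h
    · exact ⟨t, ⟨ht.1, le_of_lt h⟩, rfl⟩
    have h : L - ρ < t := h
    have hLL : L ∈ Icc 0 L := ⟨hL.le, le_rfl⟩
    refine mem_image_of_foot_points hp hG hu ha0 ha1 hfin hW
      (fun s hs s' hs' => hosc s s' (hnear s hs) (hnear s' hs')) (uIcc_subset_Icc hLL ht)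
      (by rw [abs_le]; constructor <;> linarith [ht.2]) ⟨0, h0W, hclosed.symm⟩ ?_
    intro t' ht' s₀ hs₀ hmin
    rw [uIcc_of_ge ht.2] at ht'
    have hy : ‖G t' - G 0‖ < ρ := by
      rw [← hclosed]
      refine (norm_sub_le_of_unit_speed hG hu L t').trans_lt ?_
      rw [abs_lt]; constructor <;> linarith [ht'.1, ht'.2]
    have hlt := norm_foot_point_sub_lt h0W rfl hmin hy
    have hne1 : s₀ ≠ ε := by rintro rfl; linarith
    have h5 := inner_le_zero_of_isMinOn (hG s₀) ⟨hs₀.1, lt_of_le_of_ne hs₀.2 hne1⟩ hmin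
    rw [abs_of_nonpos h5]
    rcases hs₀.1.eq_or_lt with h6 | h6
    · rw [← h6]
      exact hchord t' ⟨h.trans_le ht'.1, ht'.2⟩
    · have h7 := inner_nonneg_of_isMinOn (hG s₀) ⟨h6, hs₀.2⟩ hmin
      rw [le_antisymm h5 h7, neg_zero]
      exact mul_nonneg (by linarith) (norm_nonneg _)
  refine hchart (2 * ε) (by linarith) h1 r hr _ _ ?_ ?_
  · rintro _ ⟨⟨t, ht, rfl⟩, htr⟩
    obtain ⟨s, hs, hst⟩ := hcontain t ht htr
    exact ⟨s, ⟨⟨by linarith [hs.1], by linarith [hs.2]⟩, hs.1⟩, hst⟩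
  · rintro _ ⟨k, ⟨hk, hk0⟩, rfl⟩
    exact ⟨k, ⟨hk0, by linarith [hk.2]⟩, rfl⟩

/-- A point attained at an interior parameter has a line chart, whatever else passes through it.
Otherwise only end points hit it: a single one gives a boundary chart, and a common one gives a
smooth closing if the tangents agree and a fold if not. -/
theorem hasChartAt_image [CompleteSpace E] (hp : 2 ≤ p) (hL : 0 < L) (hv : Continuous v)
    (hG : ∀ s, HasDerivAt G (v s) s) (hu : ∀ s, ‖v s‖ = 1)
    (hfin : ∫⁻ t in Icc 0 L, ∫⁻ s in Icc 0 L, tangentPointDensity p G v t s ≠ ⊤)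
    {x : E} (hx : x ∈ G '' Icc 0 L) :
    HasChartAt (G '' Icc 0 L) x univ ∨ HasChartAt (G '' Icc 0 L) x (Ici 0) := by
  by_cases hint : ∃ s ∈ Ioo 0 L, G s = x
  · obtain ⟨s, hs, rfl⟩ := hint
    exact Or.inl (hasChartAt_interior_point hp hv hG hu hfin hs)
  have honly : ∀ t ∈ Icc 0 L, G t = x → t = 0 ∨ t = L := by
    intro t ht h
    by_contra! hcon
    exact hint ⟨t, ⟨lt_of_le_of_ne ht.1 hcon.1.symm, lt_of_le_of_ne ht.2 hcon.2⟩, h⟩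
  by_cases h0 : G 0 = x
  · subst h0
    by_cases hL' : G L = G 0
    · by_cases ht : v L = v 0
      · exact Or.inl (hasChartAt_closing_point hL hv hG hu hL' ht honly)
      · exact Or.inr (hasChartAt_common_endpoint hp hL hv hG hu hfin hL' ht honly)
    · refine Or.inr (hasChartAt_left_endpoint hL hv hG hu fun t ht h => ?_)
      rcases honly t ht h with h' | h'
      · exact h'
      · exact absurd (h' ▸ h) hL'
  · obtain ⟨t, ht, rfl⟩ := hx
    rcases honly t ht rfl with rfl | rfl
    · exact absurd rfl h0
    · refine Or.inr (hasChartAt_right_endpoint hL hv hG hu fun s hs h => ?_)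
      rcases honly s hs h with rfl | h'
      · exact absurd h h0
      · exact h'

end Embedded

/-! ### The main theorem. -/

theorem mainTheorem5 (p M : ℝ) (hp : 2 < p) (hM : 0 < M) :
    ∃ C : ℝ, 0 < C ∧
      ∀ (d : ℕ) (L : ℝ) (γ : ℝ → EuclideanSpace ℝ (Fin d)),
        0 < L →
        ContDiffOn ℝ 1 γ (Icc 0 L) →
        (∀ s ∈ Icc 0 L, ‖curveDeriv L γ s‖ = 1) →
        tangentPointEnergy p L γ ≤ ENNReal.ofReal M →
        MemSlobodeckijOne (1 - 1 / p) p (Ioo 0 L) γ ∧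
          IsEmbeddedOneSubmanifoldWithBoundary (γ '' Icc 0 L) ∧
          gagliardoPow (1 - 1 / p) p (Ioo 0 L) (curveDeriv L γ) ≤ ENNReal.ofReal C := by
  obtain ⟨C, hC, hbound⟩ := exists_lintegral_diffQuotPow_le hp
  refine ⟨C * M, by positivity, ?_⟩
  intro d L γ hL hγ hunit hE
  obtain ⟨G, v, hv, hG, hu, hGγ, hvγ⟩ := exists_unit_speed_extension hL hγ hunit
  have hGc : Continuous G := continuous_iff_continuousAt.2 fun s => (hG s).continuousAt
  have hen : ∫⁻ t in Icc 0 L, ∫⁻ s in Icc 0 L, tangentPointDensity p G v t s ≤ ENNReal.ofReal M :=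
    (lintegral_tangentPointDensity_le (by linarith) hu hGγ hvγ).trans hE
  have hgag : gagliardoPow (1 - 1 / p) p (Ioo 0 L) (curveDeriv L γ) ≤ ENNReal.ofReal (C * M) := by
    rw [gagliardoPow_eq_lintegral_diffQuotPow (by linarith) hvγ, ENNReal.ofReal_mul hC.le]
    refine (hbound G v L hv hG hu).trans ?_
    gcongr
    refine le_trans ?_ hen
    refine (lintegral_mono_set Ioc_subset_Icc_self).trans (lintegral_mono fun t => ?_)
    exact lintegral_mono_set Ioc_subset_Icc_self
  refine ⟨⟨memLp_Ioo_of_eqOn hGc hGγ _, curveDeriv L γ,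
    hasWeakDeriv_of_hasDerivAt hv hG hL hGγ hvγ, memLp_Ioo_of_eqOn hv hvγ _,
    hgag.trans_lt ENNReal.ofReal_lt_top⟩, ?_, hgag⟩
  rw [← image_congr hGγ]
  intro x hx
  rcases hasChartAt_image hp.le hL hv hG hu (hen.trans_lt ENNReal.ofReal_lt_top).ne hx with h | h
  · obtain ⟨Φ, e, h1, h2, h3, h4, h5⟩ := h
    exact ⟨Φ, e, h1, h2, h3, h4, Or.inl (by simpa using h5)⟩
  · obtain ⟨Φ, e, h1, h2, h3, h4, h5⟩ := h
    exact ⟨Φ, e, h1, h2, h3, h4, Or.inr h5⟩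

end
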